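/- Let $X$ be a locally compact, connected, locally connected Hausdorff space that is not compact. Call a subset of $X$ bounded if its closure is compact; the empty set counts as connected, and components are connected components. A set $A\subseteq X$ is solid if $A$ is connected and every component of $X\setminus A$ is unbounded; it is semi-solid if $A$ is connected and $X\setminus A$ has only finitely many components. Let $\mathcal K_s$ be the family of compact solid sets, $\mathcal O_s^*$ the family of bounded open solid sets, $\mathcal A_s^*=\mathcal K_s\cup\mathcal O_s^*$, and let $\mathcal K_0$ be the family of finite disjoint unions of compact connected sets. A solid set function is a function $\lambda:\mathcal A_s^*\to[0,\infty)$ such that (s1) $\sum_{i=1}^n\lambda(C_i)\le\lambda(C)$ whenever $C,C_i\in\mathcal K_s$, the $C_i$ are pairwise disjoint and $\bigcup_{i=1}^n C_i\subseteq C$; (s2) $\lambda(U)=\sup\{\lambda(K):K\in\mathcal K_s,\ K\subseteq U\}$ for $U\in\mathcal O_s^*$; (s3) $\lambda(K)=\inf\{\lambda(U):U\in\mathcal O_s^*,\ K\subseteq U\}$ for $K\in\mathcal K_s$; (s4) $\lambda(A)=\sum_{i=1}^n\lambda(A_i)$ whenever $A,A_i\in\mathcal A_s^*$ and $A$ is the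 disjoint union of $A_1,\dots,A_n$. A topological measure on $X$ is a function $\mu$, not identically $\infty$, from the family of all open and all closed subsets of $X$ to $[0,\infty]$ such that $\mu(A\cup B)=\mu(A)+\mu(B)$ whenever $A,B$ are disjoint and each of $A,B,A\cup B$ is compact or open; $\mu(U)=\sup\{\mu(K):K\text{ compact},\ K\subseteq U\}$ for $U$ open; and $\mu(F)=\inf\{\mu(U):U\text{ open},\ F\subseteq U\}$ for $F$ closed. It is compact-finite if $\mu(K)<\infty$ for every compact $K$. Theorem. Let $\lambda$ be a solid set function on $X$. There is a compact-finite topological measure $\mu$ on $X$ with $\mu=\lambda$ on $\mathcal A_s^*$, and every topological measure on $X$ that agrees with $\lambda$ on $\mathcal A_s^*$ equals $\mu$. Moreover, $\mu$ is obtained from $\lambda$ as follows. (1) Let $A$ be a compact connected set, a compact semi-solid set, or a bounded open semi-solid set, let $\{B_i\}_{i\in I}$ be the (possibly infinite) family of bounded components of $X\setminus A$, and let $\tilde A=A\cup\bigcup_{i\in I}B_i$ be the solid hull of $A$. Then $\tilde A\in\mathcal A_s^*$, every $B_i\in\mathcal A_s^*$, and $\mu(A)=\lambda(\tilde A)-\sum_{i\in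 I}\lambda(B_i)$. (2) If $K_1,\dots,K_n$ are pairwise disjoint compact connected sets, then $\mu(K_1\cup\dots\cup K_n)=\sum_{i=1}^n\mu(K_i)$. (3) $\mu(U)=\sup\{\mu(K):K\in\mathcal K_0,\ K\subseteq U\}$ for every open $U$, and $\mu(F)=\inf\{\mu(U):U\text{ open},\ F\subseteq U\}$ for every closed $F$. -/

import Mathlib

open Set
open scoped ENNReal NNReal

namespace SolidTM

variable {X : Type*} [TopologicalSpace X]

/-- The set of connected components of a subset `S` of `X`. -/
def components (S : Set X) : Set (Set X) :=
  {C | ∃ x ∈ S, C = connectedComponentIn S x}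

/-- A set is bounded if its closure is compact. -/
def IsBdd (A : Set X) : Prop := IsCompact (closure A)

/-- A set is solid if it is connected (the empty set counts as connected) and all components of
its complement are unbounded. -/
def IsSolid (A : Set X) : Prop :=
  IsPreconnected A ∧ ∀ C ∈ components Aᶜ, ¬ IsBdd C

/-- A set is semi-solid if it is connected (the empty set counts as connected) and its complement
has only finitely many components. -/
def IsSemiSolid (A : Set X) : Prop :=
  IsPreconnected A ∧ (components Aᶜ).Finite

/-- The compact solid sets. -/
def CompactSolid : Set (Set X) := {A | IsCompact A ∧ IsSolid A}

/-- The bounded open solid sets. -/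
def OpenSolid : Set (Set X) := {A | IsOpen A ∧ IsBdd A ∧ IsSolid A}

/-- The compact solid sets together with the bounded open solid sets. -/
def BddSolid : Set (Set X) := CompactSolid ∪ OpenSolid

/-- The compact semi-solid sets together with the bounded open semi-solid sets. -/
def BddSemiSolid : Set (Set X) :=
  {A | IsSemiSolid A ∧ (IsCompact A ∨ (IsOpen A ∧ IsBdd A))}

/-- The compact connected sets (the empty set included). -/
def CompactConn : Set (Set X) := {A | IsCompact A ∧ IsPreconnected A}

/-- The finite disjoint unions of compact connected sets. -/
def CompactConnUnion : Set (Set X) :=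
  {A | ∃ (n : ℕ) (K : Fin n → Set X), (∀ i, K i ∈ CompactConn) ∧
    Pairwise (Function.onFun Disjoint K) ∧ A = ⋃ i, K i}

/-- The bounded components of the complement of `A`. -/
def holes (A : Set X) : Set (Set X) := {B | B ∈ components Aᶜ ∧ IsBdd B}

/-- The solid hull of `A`: `A` together with all bounded components of its complement. -/
def solidHull (A : Set X) : Set X := A ∪ ⋃₀ holes A

/-- `lam` is a solid set function: a `[0, ∞)`-valued function on the family `BddSolid`
(only its values on that family matter) with the four defining properties. -/
structure IsSolidSetFunction (lam : Set X → ℝ≥0) : Prop where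
  superadd : ∀ (n : ℕ) (C : Fin n → Set X) (D : Set X), (∀ i, C i ∈ CompactSolid) →
    D ∈ CompactSolid → Pairwise (Function.onFun Disjoint C) → (⋃ i, C i) ⊆ D →
    ∑ i, lam (C i) ≤ lam D
  inner_regular : ∀ U ∈ OpenSolid, IsLUB (lam '' {K | K ∈ CompactSolid ∧ K ⊆ U}) (lam U)
  outer_regular : ∀ K ∈ CompactSolid, IsGLB (lam '' {U | U ∈ OpenSolid ∧ K ⊆ U}) (lam K)
  partition : ∀ (n : ℕ) (A : Fin n → Set X) (D : Set X), (∀ i, A i ∈ BddSolid) →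
    D ∈ BddSolid → Pairwise (Function.onFun Disjoint A) → D = ⋃ i, A i →
    lam D = ∑ i, lam (A i)

/-- `μ` is a topological measure: a `[0, ∞]`-valued function on the open and the closed sets
(only its values on those sets matter), not identically `∞`, additive on compact and open sets,
inner regular on open sets and outer regular on closed sets. -/
structure IsTopologicalMeasure (μ : Set X → ℝ≥0∞) : Prop where
  not_top : ∃ A, (IsOpen A ∨ IsClosed A) ∧ μ A ≠ ∞
  additive : ∀ A B : Set X, (IsCompact A ∨ IsOpen A) → (IsCompact B ∨ IsOpen B) →
    (IsCompact (A ∪ B) ∨ IsOpen (A ∪ B)) → Disjoint A B → μ (A ∪ B) = μ A + μ B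
  inner_regular : ∀ U : Set X, IsOpen U → μ U = ⨆ K ∈ {K : Set X | IsCompact K ∧ K ⊆ U}, μ K
  outer_regular : ∀ F : Set X, IsClosed F → μ F = ⨅ U ∈ {U : Set X | IsOpen U ∧ F ⊆ U}, μ U

/-- A set function is compact-finite if it is finite on compact sets. -/
def IsCompactFinite (μ : Set X → ℝ≥0∞) : Prop := ∀ K : Set X, IsCompact K → μ K < ∞

/-- `μ` extends `lam`: the two agree on bounded open solid and compact solid sets. -/
def Extends (μ : Set X → ℝ≥0∞) (lam : Set X → ℝ≥0) : Prop :=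
  ∀ A ∈ (BddSolid : Set (Set X)), μ A = lam A

end SolidTM

/-!
The extension is built from inside. A connected set `A` receives the value
`connValue lam A = lam (solidHull A) - ∑ lam B` over its holes `B`, an open set receives the
supremum of the total values of finite families of disjoint compact connected subsets, and every
other set the infimum of the values of its open neighbourhoods (`extension`).

Everything rests on the nesting of disjoint connected sets: of two such sets either one lies in a
hole of the other, or their solid hulls are disjoint. In a finite disjoint family the solid hulls of
the outermost members are therefore disjoint solid sets, and the other members lie in their holes,
which are solid sets again (`sum_eq_sum_outermost`). Induction on the number of members turns the
axioms for solid sets into statements about connected sets: superadditivity gives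
`IsSolidSetFunction.sum_connValue_le`, and additivity on partitions gives
`IsSolidSetFunction.le_sum_connValue`. The first, combined with the regularity of `lam`, shows that
the extension has the expected values on solid and on compact connected sets.

The one hard property of a topological measure is `μ W ≤ μ K + μ (W \ K)` for `K` compact in an open
set `W` (`IsSolidSetFunction.openValue_le_add_sdiff`). Local connectedness and local compactness
provide a compact `P ⊆ W \ K` such that `P` and its complement have finitely many components, and
such that a given compact subset of `W` is covered by `P` and by components of the complement close
to `K`. These finitely many pieces are compact connected or bounded open semi-solid, so
`le_sum_connValue` applies, and it remains to see that `connValue` does not exceed the extension on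
bounded open semi-solid sets (`IsSolidSetFunction.connValue_le_openValue_of_isOpen`).

For uniqueness, a topological measure is additive on the decomposition of a solid hull into the set
and its holes, hence is determined on compact connected sets, then on their finite disjoint unions,
which are cofinal among the compact subsets of an open set, and finally by regularity everywhere.
-/

open scoped Topology

/-! ### Components, holes and solid hulls -/

namespace SolidTM
section Components
variable {X : Type*} [TopologicalSpace X] {S T A B C : Set X}

lemma subset_of_mem_components (h : C ∈ components S) : C ⊆ S := by
  obtain ⟨x, -, rfl⟩ := h
  exact connectedComponentIn_subset S x

lemma nonempty_of_mem_components (h : C ∈ components S) : C.Nonempty := by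
  obtain ⟨x, hx, rfl⟩ := h
  exact ⟨x, mem_connectedComponentIn hx⟩

lemma isPreconnected_of_mem_components (h : C ∈ components S) : IsPreconnected C := by
  obtain ⟨x, -, rfl⟩ := h
  exact isPreconnected_connectedComponentIn

lemma eq_connectedComponentIn {x : X} (h : C ∈ components S) (hx : x ∈ C) :
    C = connectedComponentIn S x := by
  obtain ⟨y, -, rfl⟩ := h
  exact connectedComponentIn_eq hx

lemma exists_mem_components {x : X} (hx : x ∈ S) : ∃ C ∈ components S, x ∈ C :=
  ⟨_, ⟨x, hx, rfl⟩, mem_connectedComponentIn hx⟩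

lemma sUnion_components (S : Set X) : ⋃₀ components S = S := by
  apply Subset.antisymm
  · exact sUnion_subset fun C hC => subset_of_mem_components hC
  · exact fun x hx => exists_mem_components hx

lemma subset_of_mem_components_of_inter (h : C ∈ components S) (hT : IsPreconnected T)
    (hTS : T ⊆ S) (hn : (T ∩ C).Nonempty) : T ⊆ C := by
  obtain ⟨x, hxT, hxC⟩ := hn
  rw [eq_connectedComponentIn h hxC]
  exact hT.subset_connectedComponentIn hxT hTS

lemma eq_of_mem_components (hB : B ∈ components S) (hC : C ∈ components S)
    (hn : (B ∩ C).Nonempty) : B = C := by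
  obtain ⟨x, hxB, hxC⟩ := hn
  rw [eq_connectedComponentIn hB hxB, eq_connectedComponentIn hC hxC]

lemma disjoint_of_mem_components (hB : B ∈ components S) (hC : C ∈ components S)
    (hn : B ≠ C) : Disjoint B C := by
  rw [Set.disjoint_iff_inter_eq_empty, ← Set.not_nonempty_iff_eq_empty]
  exact fun h => hn (eq_of_mem_components hB hC h)

lemma pairwiseDisjoint_components (S : Set X) : (components S).PairwiseDisjoint id :=
  fun _ hB _ hC hn => disjoint_of_mem_components hB hC hn

lemma isClosed_of_mem_components (hS : IsClosed S) (hC : C ∈ components S) : IsClosed C := by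
  obtain ⟨x, hx⟩ := nonempty_of_mem_components hC
  rw [← closure_subset_iff_isClosed]
  exact subset_of_mem_components_of_inter hC (isPreconnected_of_mem_components hC).closure
    (closure_minimal (subset_of_mem_components hC) hS) ⟨x, subset_closure hx, hx⟩

lemma isOpen_of_mem_components [LocallyConnectedSpace X] (hS : IsOpen S)
    (hC : C ∈ components S) : IsOpen C := by
  obtain ⟨x, -, rfl⟩ := hC
  exact hS.connectedComponentIn

lemma components_of_isPreconnected (hS : IsPreconnected S) : components S ⊆ {S} := by
  rintro _ ⟨x, hx, rfl⟩
  exact hS.connectedComponentIn hx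

/-- A finite union of connected sets has finitely many components. -/
lemma finite_components_sUnion {F : Set (Set X)} (hF : F.Finite)
    (hc : ∀ A ∈ F, IsPreconnected A) : (components (⋃₀ F)).Finite := by
  have hsub : components (⋃₀ F) ⊆
      ⋃ A ∈ F, {C | C ∈ components (⋃₀ F) ∧ (A ∩ C).Nonempty} := by
    intro C hC
    obtain ⟨x, hx⟩ := nonempty_of_mem_components hC
    obtain ⟨A, hA, hxA⟩ := subset_of_mem_components hC hx
    simp only [mem_iUnion]
    exact ⟨A, hA, hC, x, hxA, hx⟩
  refine (hF.biUnion fun A hA => Set.Subsingleton.finite ?_).subset hsub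
  rintro C ⟨hC, y, hyA, hyC⟩ D ⟨hD, hAD⟩
  exact eq_of_mem_components hC hD
    ⟨y, hyC, subset_of_mem_components_of_inter hD (hc A hA) (subset_sUnion_of_mem hA) hAD hyA⟩

end Components

section Bounded
variable {X : Type*} [TopologicalSpace X] {S T A B C D : Set X}

lemma IsBdd.mono (hB : IsBdd B) (h : A ⊆ B) : IsBdd A :=
  hB.of_isClosed_subset isClosed_closure (closure_mono h)

lemma isBdd_of_isCompact [T2Space X] (hA : IsCompact A) : IsBdd A := by
  rwa [IsBdd, hA.isClosed.closure_eq]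

lemma isBdd_union (hA : IsBdd A) (hB : IsBdd B) : IsBdd (A ∪ B) := by
  rw [IsBdd, closure_union]
  exact hA.union hB

lemma isCompact_of_isClosed_isBdd (h : IsClosed A) (hb : IsBdd A) : IsCompact A := by
  rwa [IsBdd, h.closure_eq] at hb

lemma not_isBdd_compl [NoncompactSpace X] (hB : IsBdd B) : ¬ IsBdd Bᶜ := by
  intro h
  apply noncompact_univ X
  have := isBdd_union hB h
  rwa [union_compl_self, IsBdd, closure_univ] at this

lemma isSolid_of_mem_BddSolid (h : A ∈ BddSolid) : IsSolid A :=
  h.elim (fun h => h.2) fun h => h.2.2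

end Bounded

section Join
variable {X : Type*} [TopologicalSpace X] {S T A B C D : Set X}

lemma isPreconnected_union_of_closure_inter (hA : IsPreconnected A) (hB : IsPreconnected B)
    (h : (A ∩ closure B).Nonempty) : IsPreconnected (A ∪ B) := by
  obtain ⟨y, hyA, hyB⟩ := h
  have h2 : IsPreconnected (insert y B) :=
    hB.subset_closure (subset_insert _ _) (insert_subset hyB subset_closure)
  have := IsPreconnected.union y hyA (mem_insert _ _) hA h2
  rwa [union_insert, insert_eq_of_mem (show y ∈ A ∪ B from Or.inl hyA)] at this

lemma isPreconnected_union_sUnion {F : Set (Set X)} (hA : IsPreconnected A) (hne : A.Nonempty)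
    (hF : ∀ B ∈ F, IsPreconnected (A ∪ B)) : IsPreconnected (A ∪ ⋃₀ F) := by
  obtain ⟨a, ha⟩ := hne
  have : A ∪ ⋃₀ F = ⋃₀ (insert A ((fun B => A ∪ B) '' F)) := by
    ext x
    simp only [mem_union, mem_sUnion, mem_insert_iff, mem_image, exists_eq_or_imp]
    constructor
    · rintro (h | ⟨B, hB, hx⟩)
      · exact Or.inl h
      · exact Or.inr ⟨_, ⟨B, hB, rfl⟩, Or.inr hx⟩
    · rintro (h | ⟨_, ⟨B, hB, rfl⟩, hx | hx⟩)
      · exact Or.inl h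
      · exact Or.inl hx
      · exact Or.inr ⟨B, hB, hx⟩
  rw [this]
  refine isPreconnected_sUnion a _ ?_ ?_
  · rintro _ (rfl | ⟨B, -, rfl⟩)
    · exact ha
    · exact Or.inl ha
  · rintro _ (rfl | ⟨B, hB, rfl⟩)
    · exact hA
    · exact hF B hB

/-- In a connected, locally connected space, a connected set stays connected when a component of
its complement is added. -/
lemma isPreconnected_union_component [PreconnectedSpace X] [LocallyConnectedSpace X]
    (hA : IsPreconnected A) (hne : A.Nonempty) (hB : B ∈ components Aᶜ) :
    IsPreconnected (A ∪ B) := by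
  have hBc := isPreconnected_of_mem_components hB
  by_cases h1 : (B ∩ closure A).Nonempty
  · rw [union_comm]
    exact isPreconnected_union_of_closure_inter hBc hA h1
  by_cases h2 : (A ∩ closure B).Nonempty
  · exact isPreconnected_union_of_closure_inter hA hBc h2
  -- otherwise `B` would be open and closed
  exfalso
  have hcl : IsClosed B := by
    rw [← closure_subset_iff_isClosed]
    obtain ⟨x, hx⟩ := nonempty_of_mem_components hB
    refine subset_of_mem_components_of_inter hB hBc.closure ?_ ⟨x, subset_closure hx, hx⟩
    exact fun z hz hzA => h2 ⟨z, hzA, hz⟩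
  have hop : IsOpen B := by
    rw [isOpen_iff_mem_nhds]
    intro x hx
    have hmem : Aᶜ ∈ 𝓝 x := by
      have : x ∉ closure A := fun h => h1 ⟨x, hx, h⟩
      exact Filter.mem_of_superset (isClosed_closure.isOpen_compl.mem_nhds this)
        (compl_subset_compl.2 subset_closure)
    rw [eq_connectedComponentIn hB hx]
    exact connectedComponentIn_mem_nhds hmem
  rcases isClopen_iff.1 ⟨hcl, hop⟩ with h | h
  · exact (nonempty_of_mem_components hB).ne_empty h
  · obtain ⟨a, ha⟩ := hne
    exact subset_of_mem_components hB (h ▸ mem_univ a) ha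

lemma compl_union_sUnion_components {F : Set (Set X)} (hF : F ⊆ components Aᶜ) :
    (A ∪ ⋃₀ F)ᶜ = ⋃₀ (components Aᶜ \ F) := by
  ext x
  constructor
  · intro hx
    obtain ⟨C, hC, hxC⟩ := exists_mem_components (S := Aᶜ) fun h => hx (Or.inl h)
    exact ⟨C, ⟨hC, fun h => hx (Or.inr ⟨C, h, hxC⟩)⟩, hxC⟩
  · rintro ⟨C, ⟨hC, hCF⟩, hxC⟩ (h | ⟨B, hB, hxB⟩)
    · exact subset_of_mem_components hC hxC h
    · exact hCF (eq_of_mem_components hC (hF hB) ⟨x, hxC, hxB⟩ ▸ hB)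

/-- Adding components of the complement to a set removes exactly these from the components of its
complement. -/
lemma components_compl_union_sUnion {F : Set (Set X)} (hF : F ⊆ components Aᶜ) :
    components (A ∪ ⋃₀ F)ᶜ = components Aᶜ \ F := by
  have key : ∀ C ∈ components Aᶜ \ F, ∀ x ∈ C, connectedComponentIn (A ∪ ⋃₀ F)ᶜ x = C := by
    intro C hC x hx
    have hsub : C ⊆ (A ∪ ⋃₀ F)ᶜ := by
      rw [compl_union_sUnion_components hF]
      exact subset_sUnion_of_mem hC
    apply Subset.antisymm
    · rw [eq_connectedComponentIn hC.1 hx]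
      exact connectedComponentIn_mono x (compl_subset_compl.2 subset_union_left)
    · exact (isPreconnected_of_mem_components hC.1).subset_connectedComponentIn hx hsub
  ext C
  constructor
  · rintro ⟨x, hx, rfl⟩
    have hx' := hx
    rw [compl_union_sUnion_components hF] at hx'
    obtain ⟨C, hC, hxC⟩ := hx'
    rwa [key C hC x hxC]
  · intro hC
    obtain ⟨x, hx⟩ := nonempty_of_mem_components hC.1
    refine ⟨x, ?_, (key C hC x hx).symm⟩
    rw [compl_union_sUnion_components hF]
    exact ⟨C, hC, hx⟩

/-- In a connected, locally connected space, the complement of a component of the complement of a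
connected set is connected. -/
lemma isPreconnected_compl_of_mem_components [PreconnectedSpace X] [LocallyConnectedSpace X]
    (hA : IsPreconnected A) (hne : A.Nonempty) (hB : B ∈ components Aᶜ) :
    IsPreconnected Bᶜ := by
  have h := isPreconnected_union_sUnion hA hne (F := components Aᶜ \ {B})
    fun C hC => isPreconnected_union_component hA hne hC.1
  have h2 := compl_union_sUnion_components (A := A) (F := components Aᶜ \ {B}) sdiff_subset
  rw [sdiff_sdiff_right_self] at h2
  have h3 : components Aᶜ ∩ {B} = {B} := by simpa using hB
  rw [h3, sUnion_singleton] at h2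
  rwa [← h2, compl_compl]

end Join

section Hull
variable {X : Type*} [TopologicalSpace X] {S T A B C D : Set X}

lemma holes_subset_components (A : Set X) : holes A ⊆ components Aᶜ := fun _ h => h.1

lemma subset_solidHull (A : Set X) : A ⊆ solidHull A := subset_union_left

lemma subset_solidHull_of_mem_holes (h : B ∈ holes A) : B ⊆ solidHull A :=
  (subset_sUnion_of_mem h).trans subset_union_right

lemma disjoint_of_mem_holes (h : B ∈ holes A) : Disjoint A B :=
  disjoint_compl_right.mono_right (subset_of_mem_components h.1)

lemma holes_of_isSolid (h : IsSolid A) : holes A = ∅ :=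
  eq_empty_of_forall_notMem fun B hB => h.2 B hB.1 hB.2

lemma solidHull_of_isSolid (h : IsSolid A) : solidHull A = A := by
  simp [solidHull, holes_of_isSolid h]

/-- A solid set contains the solid hulls of its subsets. -/
lemma solidHull_subset (hD : IsSolid D) (h : A ⊆ D) : solidHull A ⊆ D := by
  refine union_subset h (sUnion_subset fun B hB x hx => ?_)
  by_contra hxD
  obtain ⟨C, hC, hxC⟩ := exists_mem_components (S := Dᶜ) hxD
  refine hD.2 C hC (hB.2.mono ?_)
  exact subset_of_mem_components_of_inter hB.1 (isPreconnected_of_mem_components hC)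
    ((subset_of_mem_components hC).trans (compl_subset_compl.2 h)) ⟨x, hxC, hx⟩

lemma isSolid_empty [ConnectedSpace X] [NoncompactSpace X] : IsSolid (∅ : Set X) := by
  refine ⟨isPreconnected_empty, fun C hC hb => ?_⟩
  rw [compl_empty] at hC
  have := components_of_isPreconnected isPreconnected_univ hC
  rw [mem_singleton_iff] at this
  subst this
  exact noncompact_univ X (by simpa [IsBdd] using hb)

variable [ConnectedSpace X] [LocallyConnectedSpace X] [NoncompactSpace X]

lemma isSolid_solidHull (hA : IsPreconnected A) : IsSolid (solidHull A) := by
  rcases A.eq_empty_or_nonempty with rfl | hne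
  · rw [solidHull_of_isSolid isSolid_empty]
    exact isSolid_empty
  · refine ⟨isPreconnected_union_sUnion hA hne fun B hB =>
      isPreconnected_union_component hA hne hB.1, fun C hC hb => ?_⟩
    rw [solidHull, components_compl_union_sUnion (holes_subset_components A)] at hC
    exact hC.2 ⟨hC.1, hb⟩

lemma isSolid_of_mem_holes (hA : IsPreconnected A) (hB : B ∈ holes A) : IsSolid B := by
  have hne : A.Nonempty := by
    rw [nonempty_iff_ne_empty]
    rintro rfl
    rw [holes_of_isSolid isSolid_empty] at hB
    exact hB
  refine ⟨isPreconnected_of_mem_components hB.1, fun C hC hb => ?_⟩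
  have := components_of_isPreconnected (isPreconnected_compl_of_mem_components hA hne hB.1) hC
  rw [mem_singleton_iff] at this
  subst this
  exact not_isBdd_compl hB.2 hb

/-- Two disjoint connected sets either have disjoint solid hulls, or one of them lies in a hole of
the other. -/
lemma subset_hole_or_disjoint_solidHull (hA : IsPreconnected A) (hB : IsPreconnected B)
    (hd : Disjoint A B) :
    (∃ H ∈ holes A, B ⊆ H) ∨ (∃ H ∈ holes B, A ⊆ H) ∨ Disjoint (solidHull A) (solidHull B) := by
  by_cases h1 : ∃ H ∈ holes A, B ⊆ H
  · exact Or.inl h1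
  by_cases h2 : ∃ H ∈ holes B, A ⊆ H
  · exact Or.inr (Or.inl h2)
  refine Or.inr (Or.inr ?_)
  have aux : ∀ {A B : Set X}, IsPreconnected A → IsPreconnected B → Disjoint A B →
      (¬ ∃ H ∈ holes A, B ⊆ H) → Disjoint (solidHull A) B := by
    intro A B _ hB hd h
    rw [solidHull, disjoint_union_left, disjoint_sUnion_left]
    refine ⟨hd, fun H hH => ?_⟩
    rw [Set.disjoint_iff_inter_eq_empty, ← Set.not_nonempty_iff_eq_empty]
    intro hn
    exact h ⟨H, hH, subset_of_mem_components_of_inter hH.1 hB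
      (subset_compl_iff_disjoint_left.2 hd) (by rwa [inter_comm])⟩
  have hAB := aux hA hB hd h1
  rcases A.eq_empty_or_nonempty with rfl | ⟨a, ha⟩
  · rw [solidHull_of_isSolid isSolid_empty]
    exact empty_disjoint _
  rw [disjoint_comm]
  refine aux hB (isSolid_solidHull hA).1 hAB.symm ?_
  rintro ⟨H, hH, hs⟩
  exact h2 ⟨H, hH, (subset_solidHull A).trans hs⟩

end Hull
end SolidTM

/-! ### Components in locally compact, locally connected spaces -/

namespace SolidTM
section Geometry
variable {X : Type*} [TopologicalSpace X] {A B C D K N O P U V : Set X}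

lemma subset_interior_or_of_disjoint_frontier (hB : IsPreconnected B)
    (h : Disjoint B (frontier N)) : B ⊆ interior N ∨ B ⊆ (closure N)ᶜ := by
  refine hB.subset_or_subset isOpen_interior isClosed_closure.isOpen_compl ?_ ?_
  · exact disjoint_compl_right.mono_left (interior_subset.trans subset_closure)
  · intro x hx
    by_cases h1 : x ∈ interior N
    · exact Or.inl h1
    · exact Or.inr fun h2 => disjoint_left.1 h hx ⟨h2, h1⟩

/-- A component of the complement of a nonempty closed set touches this set. -/
lemma closure_inter_nonempty_of_mem_components [PreconnectedSpace X] [LocallyConnectedSpace X]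
    (hP : IsClosed P) (hne : P.Nonempty) (hH : B ∈ components Pᶜ) : (P ∩ closure B).Nonempty := by
  by_contra h
  have hcl : IsClosed B := by
    rw [← closure_subset_iff_isClosed]
    obtain ⟨x, hx⟩ := nonempty_of_mem_components hH
    refine subset_of_mem_components_of_inter hH (isPreconnected_of_mem_components hH).closure ?_
      ⟨x, subset_closure hx, hx⟩
    exact fun z hz hzA => h ⟨z, hzA, hz⟩
  rcases isClopen_iff.1 ⟨hcl, isOpen_of_mem_components hP.isOpen_compl hH⟩ with h | h
  · exact (nonempty_of_mem_components hH).ne_empty h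
  · obtain ⟨a, ha⟩ := hne
    exact subset_of_mem_components hH (h ▸ mem_univ a) ha

/-- All but finitely many components of the complement of `P` stay in a given compact
neighbourhood of `P`, since the others cover its frontier. -/
lemma finite_components_not_subset_interior [T2Space X] [PreconnectedSpace X]
    [LocallyConnectedSpace X] (hP : IsClosed P) (hne : P.Nonempty) (hN : IsCompact N)
    (hPN : P ⊆ interior N) : {H | H ∈ components Pᶜ ∧ ¬ H ⊆ interior N}.Finite := by
  have hfr : frontier N ⊆ ⋃ H ∈ components Pᶜ, H := by
    rw [← sUnion_eq_biUnion, sUnion_components]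
    exact fun x hx hxP => hx.2 (hPN hxP)
  have hfc : IsCompact (frontier N) := hN.of_isClosed_subset isClosed_frontier
    (hN.isClosed.frontier_subset)
  obtain ⟨b, hb, hbf, hcov⟩ := hfc.elim_finite_subcover_image
    (fun H hH => isOpen_of_mem_components hP.isOpen_compl hH) hfr
  refine hbf.subset ?_
  rintro H ⟨hH, hHN⟩
  have hmeet : ¬ Disjoint H (frontier N) := by
    intro hd
    rcases subset_interior_or_of_disjoint_frontier (isPreconnected_of_mem_components hH) hd
      with h | h
    · exact hHN h
    · obtain ⟨x, hxP, hxH⟩ := closure_inter_nonempty_of_mem_components hP hne hH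
      have h2 : closure H ⊆ (interior N)ᶜ := closure_minimal
        (h.trans (compl_subset_compl.2 (interior_subset.trans subset_closure)))
        isOpen_interior.isClosed_compl
      exact h2 hxH (hPN hxP)
  obtain ⟨x, hxH, hxN⟩ := not_disjoint_iff.1 hmeet
  obtain ⟨H', hH', hxH'⟩ := mem_iUnion₂.1 (hcov hxN)
  rwa [eq_of_mem_components hH (hb hH') ⟨x, hxH, hxH'⟩]

lemma exists_compactConn_mem_nhds [T2Space X] [LocallyCompactSpace X] [LocallyConnectedSpace X]
    {x : X} (hU : IsOpen U) (hx : x ∈ U) : ∃ C ∈ CompactConn, C ∈ 𝓝 x ∧ C ⊆ U := by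
  obtain ⟨L, hL, hxL, hLU⟩ := exists_compact_subset hU hx
  obtain ⟨V, hV, hVo, hxV, hVc⟩ := locallyConnectedSpace_iff_subsets_isOpen_isConnected.1
    ‹_› x (interior L) (isOpen_interior.mem_nhds hxL)
  have hVL : closure V ⊆ L := closure_minimal (hV.trans interior_subset) hL.isClosed
  exact ⟨closure V, ⟨hL.of_isClosed_subset isClosed_closure hVL, hVc.isPreconnected.closure⟩,
    Filter.mem_of_superset (hVo.mem_nhds hxV) subset_closure, hVL.trans hLU⟩

lemma union_mem_compactConn {x : X} (hA : A ∈ CompactConn) (hB : B ∈ CompactConn) (hxA : x ∈ A)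
    (hxB : x ∈ B) : A ∪ B ∈ CompactConn :=
  ⟨hA.1.union hB.1, IsPreconnected.union x hxA hxB hA.2 hB.2⟩

lemma exists_compactConn_of_mem_of_mem [T2Space X] [LocallyCompactSpace X]
    [LocallyConnectedSpace X] (hU : IsOpen U) (hUc : IsPreconnected U) {x y : X} (hx : x ∈ U)
    (hy : y ∈ U) : ∃ C ∈ CompactConn, x ∈ C ∧ y ∈ C ∧ C ⊆ U := by
  refine hUc.induction₂ (fun x y => ∃ C ∈ CompactConn, x ∈ C ∧ y ∈ C ∧ C ⊆ U) ?_ ?_ ?_ hx hy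
  · intro x hx
    obtain ⟨C, hC, hCx, hCU⟩ := exists_compactConn_mem_nhds hU hx
    filter_upwards [mem_nhdsWithin_of_mem_nhds hCx] with y hy
    exact ⟨C, hC, mem_of_mem_nhds hCx, hy, hCU⟩
  · rintro x y z - - - ⟨C, hC, hxC, hyC, hCU⟩ ⟨D, hD, hyD, hzD, hDU⟩
    exact ⟨C ∪ D, union_mem_compactConn hC hD hyC hyD, Or.inl hxC, Or.inr hzD,
      union_subset hCU hDU⟩
  · rintro x y - - ⟨C, hC, hxC, hyC, hCU⟩
    exact ⟨C, hC, hyC, hxC, hCU⟩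

lemma exists_compactConn_between [T2Space X] [LocallyCompactSpace X] [LocallyConnectedSpace X]
    (hK : IsCompact K) (hU : IsOpen U) (hUc : IsPreconnected U) (hKU : K ⊆ U) :
    ∃ C ∈ CompactConn, K ⊆ C ∧ C ⊆ U := by
  rcases K.eq_empty_or_nonempty with rfl | ⟨a, ha⟩
  · exact ⟨∅, ⟨isCompact_empty, isPreconnected_empty⟩, Subset.rfl, empty_subset _⟩
  have : ∃ C ∈ CompactConn, insert a K ⊆ C ∧ C ⊆ U := by
    refine hK.induction_on (p := fun S => ∃ C ∈ CompactConn, insert a S ⊆ C ∧ C ⊆ U) ?_ ?_ ?_ ?_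
    · exact ⟨{a}, ⟨isCompact_singleton, isPreconnected_singleton⟩, by simp,
        singleton_subset_iff.2 (hKU ha)⟩
    · rintro S T hST ⟨C, hC, hTC, hCU⟩
      exact ⟨C, hC, (insert_subset_insert hST).trans hTC, hCU⟩
    · rintro S T ⟨C, hC, hTC, hCU⟩ ⟨D, hD, hTD, hDU⟩
      refine ⟨C ∪ D, union_mem_compactConn hC hD (hTC (mem_insert _ _)) (hTD (mem_insert _ _)), ?_,
        union_subset hCU hDU⟩
      rw [insert_union_distrib]
      exact union_subset_union hTC hTD
    · intro x hx
      obtain ⟨C, hC, hCx, hCU⟩ := exists_compactConn_mem_nhds hU (hKU hx)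
      obtain ⟨D, hD, haD, hxD, hDU⟩ := exists_compactConn_of_mem_of_mem hU hUc (hKU ha) (hKU hx)
      exact ⟨C, mem_nhdsWithin_of_mem_nhds hCx, C ∪ D,
        union_mem_compactConn hC hD (mem_of_mem_nhds hCx) hxD,
        insert_subset (Or.inr haD) subset_union_left, union_subset hCU hDU⟩
  obtain ⟨C, hC, hKC, hCU⟩ := this
  exact ⟨C, hC, (subset_insert _ _).trans hKC, hCU⟩

lemma exists_isCompact_finite_components_between [T2Space X] [LocallyCompactSpace X]
    [LocallyConnectedSpace X] (hK : IsCompact K) (hU : IsOpen U) (hKU : K ⊆ U) :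
    ∃ P, IsCompact P ∧ K ⊆ P ∧ P ⊆ U ∧ (components P).Finite := by
  have : ∃ F : Set (Set X), F.Finite ∧ (∀ C ∈ F, C ∈ CompactConn ∧ C ⊆ U) ∧ K ⊆ ⋃₀ F := by
    refine hK.induction_on (p := fun S => ∃ F : Set (Set X), F.Finite ∧
      (∀ C ∈ F, C ∈ CompactConn ∧ C ⊆ U) ∧ S ⊆ ⋃₀ F) ?_ ?_ ?_ ?_
    · exact ⟨∅, finite_empty, by simp, by simp⟩
    · rintro S T hST ⟨F, hF, hc, hT⟩
      exact ⟨F, hF, hc, hST.trans hT⟩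
    · rintro S T ⟨F, hF, hc, hS⟩ ⟨G, hG, hd, hT⟩
      refine ⟨F ∪ G, hF.union hG, fun C hC => hC.elim (hc C) (hd C), ?_⟩
      rw [sUnion_union]
      exact union_subset_union hS hT
    · intro x hx
      obtain ⟨C, hC, hCx, hCU⟩ := exists_compactConn_mem_nhds hU (hKU hx)
      exact ⟨C, mem_nhdsWithin_of_mem_nhds hCx, {C}, finite_singleton C, by simp [hC, hCU],
        by simp⟩
  obtain ⟨F, hF, hc, hKF⟩ := this
  exact ⟨⋃₀ F, hF.isCompact_sUnion fun C hC => (hc C hC).1.1, hKF,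
    sUnion_subset fun C hC => (hc C hC).2, finite_components_sUnion hF fun C hC => (hc C hC).1.2⟩

/-- Between a compact set and an open set there is a compact set which, like its complement, has
only finitely many components: take a finite union of compact connected sets and add all components
of its complement which stay close to it. -/
lemma exists_isCompact_finite_components_compl_between [T2Space X] [LocallyCompactSpace X]
    [ConnectedSpace X] [LocallyConnectedSpace X] (hK : IsCompact K) (hU : IsOpen U)
    (hKU : K ⊆ U) : ∃ P, IsCompact P ∧ K ⊆ P ∧ P ⊆ U ∧ (components P).Finite ∧
      (components Pᶜ).Finite := by
  rcases K.eq_empty_or_nonempty with rfl | hne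
  · refine ⟨∅, isCompact_empty, Subset.rfl, empty_subset _, ?_, ?_⟩
    · exact (finite_singleton _).subset (components_of_isPreconnected isPreconnected_empty)
    · rw [compl_empty]
      exact (finite_singleton _).subset (components_of_isPreconnected isPreconnected_univ)
  obtain ⟨Q, hQ, hKQ, hQU, hQf⟩ := exists_isCompact_finite_components_between hK hU hKU
  have hQne := hne.mono hKQ
  obtain ⟨N, hN, hQN, hNU⟩ := exists_compact_between hQ hU hQU
  set F : Set (Set X) := {H | H ∈ components Qᶜ ∧ H ⊆ interior N} with hFdef
  have hF : F ⊆ components Qᶜ := fun H hH => hH.1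
  have hfin : (components Qᶜ \ F).Finite := by
    refine (finite_components_not_subset_interior hQ.isClosed hQne hN hQN).subset ?_
    exact fun H hH => ⟨hH.1, fun h => hH.2 ⟨hH.1, h⟩⟩
  have hsub : Q ∪ ⋃₀ F ⊆ N := union_subset (hQN.trans interior_subset)
    (sUnion_subset fun H hH => hH.2.trans interior_subset)
  have hclosed : IsClosed (Q ∪ ⋃₀ F) := by
    rw [← isOpen_compl_iff, compl_union_sUnion_components hF]
    exact isOpen_sUnion fun H hH => isOpen_of_mem_components hQ.isClosed.isOpen_compl hH.1
  refine ⟨Q ∪ ⋃₀ F, hN.of_isClosed_subset hclosed hsub, hKQ.trans subset_union_left,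
    hsub.trans hNU, ?_, ?_⟩
  · have heq : Q ∪ ⋃₀ F =
        ⋃₀ ((fun C => C ∪ ⋃₀ {H | H ∈ F ∧ (C ∩ closure H).Nonempty}) '' components Q) := by
      rw [sUnion_image]
      ext x
      simp only [mem_iUnion]
      constructor
      · rintro (h | ⟨H, hH, hx⟩)
        · obtain ⟨C, hC, hxC⟩ := exists_mem_components h
          exact ⟨C, hC, Or.inl hxC⟩
        · obtain ⟨y, hyQ, hyH⟩ :=
            closure_inter_nonempty_of_mem_components hQ.isClosed hQne hH.1
          obtain ⟨C, hC, hyC⟩ := exists_mem_components hyQ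
          exact ⟨C, hC, Or.inr ⟨H, ⟨hH, y, hyC, hyH⟩, hx⟩⟩
      · rintro ⟨C, hC, h | ⟨H, hH, hx⟩⟩
        · exact Or.inl (subset_of_mem_components hC h)
        · exact Or.inr ⟨H, hH.1, hx⟩
    rw [heq]
    refine finite_components_sUnion (hQf.image _) ?_
    rintro _ ⟨C, hC, rfl⟩
    refine isPreconnected_union_sUnion (isPreconnected_of_mem_components hC)
      (nonempty_of_mem_components hC) fun H hH => ?_
    exact isPreconnected_union_of_closure_inter (isPreconnected_of_mem_components hC)
      (isPreconnected_of_mem_components hH.1.1) hH.2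
  · rw [components_compl_union_sUnion hF]
    exact hfin

lemma mem_openSolid_of_mem_holes [T2Space X] [ConnectedSpace X] [LocallyConnectedSpace X]
    [NoncompactSpace X] (hA : A ∈ CompactConn) (hB : B ∈ holes A) :
    B ∈ OpenSolid :=
  ⟨isOpen_of_mem_components hA.1.isClosed.isOpen_compl hB.1, hB.2, isSolid_of_mem_holes hA.2 hB⟩

lemma mem_compactSolid_of_mem_holes [ConnectedSpace X] [LocallyConnectedSpace X] [NoncompactSpace X]
    (hA : IsOpen A) (hAc : IsPreconnected A) (hB : B ∈ holes A) :
    B ∈ CompactSolid :=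
  ⟨isCompact_of_isClosed_isBdd (isClosed_of_mem_components hA.isClosed_compl hB.1) hB.2,
    isSolid_of_mem_holes hAc hB⟩

lemma isPreconnected_of_mem_bddSemiSolid_union (hA : A ∈ BddSemiSolid ∪ CompactConn) :
    IsPreconnected A :=
  hA.elim (fun h => h.1.1) fun h => h.2

lemma solidHull_mem_openSolid [T2Space X] [ConnectedSpace X] [LocallyConnectedSpace X]
    [NoncompactSpace X]
    (hA : IsOpen A) (hb : IsBdd A) (hs : IsSemiSolid A) :
    solidHull A ∈ OpenSolid := by
  refine ⟨?_, ?_, isSolid_solidHull hs.1⟩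
  · rw [← isClosed_compl_iff, solidHull,
      compl_union_sUnion_components (holes_subset_components A), sUnion_eq_biUnion]
    exact (hs.2.subset sdiff_subset).isClosed_biUnion fun H hH =>
      isClosed_of_mem_components hA.isClosed_compl hH.1
  · have hbd : IsCompact (closure A ∪ ⋃ H ∈ holes A, closure H) :=
      hb.union ((hs.2.subset (holes_subset_components A)).isCompact_biUnion fun H hH => hH.2)
    refine (isBdd_of_isCompact hbd).mono (union_subset_union subset_closure ?_)
    rw [sUnion_eq_biUnion]
    exact biUnion_mono Subset.rfl fun H _ => subset_closure

lemma holes_subset_bddSolid [T2Space X] [ConnectedSpace X] [LocallyConnectedSpace X]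
    [NoncompactSpace X] (hA : A ∈ BddSemiSolid ∪ CompactConn) : holes A ⊆ BddSolid := by
  intro B hB
  rcases hA with ⟨hs, hc | ⟨ho, -⟩⟩ | hc
  · exact Or.inr (mem_openSolid_of_mem_holes ⟨hc, hs.1⟩ hB)
  · exact Or.inl (mem_compactSolid_of_mem_holes ho hs.1 hB)
  · exact Or.inr (mem_openSolid_of_mem_holes hc hB)

section Hull
variable [T2Space X] [LocallyCompactSpace X] [ConnectedSpace X] [LocallyConnectedSpace X]
  [NoncompactSpace X]

lemma isCompact_solidHull (hA : IsCompact A) : IsCompact (solidHull A) := by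
  rcases A.eq_empty_or_nonempty with rfl | hne
  · rw [solidHull_of_isSolid isSolid_empty]
    exact isCompact_empty
  refine isCompact_of_isClosed_isBdd ?_ ?_
  · rw [← isOpen_compl_iff, solidHull, compl_union_sUnion_components (holes_subset_components A)]
    exact isOpen_sUnion fun H hH => isOpen_of_mem_components hA.isClosed.isOpen_compl hH.1
  · obtain ⟨N, hN, hAN, -⟩ := exists_compact_between hA isOpen_univ (subset_univ A)
    set F := {H | H ∈ holes A ∧ ¬ H ⊆ interior N} with hFdef
    have hF : F.Finite :=
      (finite_components_not_subset_interior hA.isClosed hne hN hAN).subset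
        fun H hH => ⟨hH.1.1, hH.2⟩
    have hbd : IsCompact (N ∪ ⋃ H ∈ F, closure H) :=
      hN.union (hF.isCompact_biUnion fun H hH => hH.1.2)
    refine (isBdd_of_isCompact hbd).mono (union_subset ?_ (sUnion_subset fun H hH => ?_))
    · exact (hAN.trans interior_subset).trans subset_union_left
    · by_cases h : H ⊆ interior N
      · exact (h.trans interior_subset).trans subset_union_left
      · exact (subset_closure.trans (subset_biUnion_of_mem (u := fun H => closure H)
          (show H ∈ F from ⟨hH, h⟩))).trans subset_union_right

lemma solidHull_mem_compactSolid (hA : A ∈ CompactConn) : solidHull A ∈ CompactSolid :=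
  ⟨isCompact_solidHull hA.1, isSolid_solidHull hA.2⟩

lemma solidHull_mem_bddSolid (hA : A ∈ BddSemiSolid ∪ CompactConn) : solidHull A ∈ BddSolid := by
  rcases hA with ⟨hs, hc | ⟨ho, hb⟩⟩ | hc
  · exact Or.inl (solidHull_mem_compactSolid ⟨hc, hs.1⟩)
  · exact Or.inr (solidHull_mem_openSolid ho hb hs)
  · exact Or.inl (solidHull_mem_compactSolid hc)

lemma exists_compactSolid_between (hK : IsCompact K) (hU : IsOpen U) (hUs : IsSolid U)
    (hKU : K ⊆ U) : ∃ C ∈ CompactSolid, K ⊆ C ∧ C ⊆ U := by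
  obtain ⟨C, hC, hKC, hCU⟩ := exists_compactConn_between hK hU hUs.1 hKU
  exact ⟨solidHull C, solidHull_mem_compactSolid hC, hKC.trans (subset_solidHull C),
    solidHull_subset hUs hCU⟩

lemma exists_compactSolid_superset (hK : IsCompact K) : ∃ C ∈ CompactSolid, K ⊆ C := by
  obtain ⟨C, hC, hKC, -⟩ := exists_compactConn_between hK isOpen_univ isPreconnected_univ
    (subset_univ K)
  exact ⟨solidHull C, solidHull_mem_compactSolid hC, hKC.trans (subset_solidHull C)⟩

end Hull
end Geometry
end SolidTM

/-! ### Nesting of disjoint connected sets -/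

namespace SolidTM
section Forest
open scoped Classical in
/-- The members of a finite family whose solid hulls are maximal: those contained in the solid hull
of no other member. -/
noncomputable def outermost {X : Type*} [TopologicalSpace X] (s : Finset (Set X)) :
    Finset (Set X) :=
  s.filter fun A => ∀ B ∈ s, A ⊆ solidHull B → B = A

variable {X : Type*} [TopologicalSpace X] {A B H : Set X} {s : Finset (Set X)}

lemma mem_outermost : A ∈ outermost s ↔ A ∈ s ∧ ∀ B ∈ s, A ⊆ solidHull B → B = A := by
  simp [outermost]

lemma exists_mem_holes_of_subset_solidHull (hB : IsPreconnected B) (hne : B.Nonempty)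
    (hd : Disjoint B A) (h : B ⊆ solidHull A) : ∃ H ∈ holes A, B ⊆ H := by
  obtain ⟨x, hx⟩ := hne
  rcases h hx with hxA | ⟨H, hH, hxH⟩
  · exact (disjoint_left.1 hd hx hxA).elim
  · exact ⟨H, hH, subset_of_mem_components_of_inter hH.1 hB
      (subset_compl_iff_disjoint_right.2 hd) ⟨x, hx, hxH⟩⟩

variable [ConnectedSpace X] [LocallyConnectedSpace X] [NoncompactSpace X]

/-- Two disjoint connected sets cannot each lie in the solid hull of the other. -/
lemma not_subset_solidHull_of_subset_solidHull (hA : IsPreconnected A) (hB : IsPreconnected B)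
    (hAne : A.Nonempty) (hBne : B.Nonempty) (hd : Disjoint A B) (h : A ⊆ solidHull B) :
    ¬ B ⊆ solidHull A := by
  intro h'
  obtain ⟨H, hH, hAH⟩ := exists_mem_holes_of_subset_solidHull hA hAne hd h
  have h1 : solidHull A ⊆ H := solidHull_subset (isSolid_of_mem_holes hB hH) hAH
  obtain ⟨b, hb⟩ := hBne
  exact disjoint_left.1 (disjoint_of_mem_holes hH) hb (h1 (h' hb))

lemma exists_mem_outermost (hc : ∀ A ∈ s, IsPreconnected A) (hne : ∀ A ∈ s, A.Nonempty)
    (hd : (s : Set (Set X)).PairwiseDisjoint id) (hA : A ∈ s) :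
    ∃ B ∈ outermost s, A ⊆ solidHull B := by
  classical
  obtain ⟨B, hB, hmax⟩ := (s.filter fun B => A ⊆ solidHull B).exists_maximalFor solidHull
    ⟨A, Finset.mem_filter.2 ⟨hA, subset_solidHull A⟩⟩
  rw [Finset.mem_filter] at hB
  refine ⟨B, mem_outermost.2 ⟨hB.1, fun C hC hBC => ?_⟩, hB.2⟩
  have h1 : solidHull B ⊆ solidHull C := solidHull_subset (isSolid_solidHull (hc C hC)) hBC
  have h2 := hmax (Finset.mem_filter.2 ⟨hC, hB.2.trans h1⟩) h1
  by_contra hCB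
  exact not_subset_solidHull_of_subset_solidHull (hc B hB.1) (hc C hC) (hne B hB.1) (hne C hC)
    (hd hB.1 hC (Ne.symm hCB)) hBC ((subset_solidHull C).trans h2)

lemma pairwiseDisjoint_solidHull_outermost (hc : ∀ A ∈ s, IsPreconnected A)
    (hd : (s : Set (Set X)).PairwiseDisjoint id) :
    (outermost s : Set (Set X)).PairwiseDisjoint solidHull := by
  intro A hA B hB hAB
  rw [Finset.mem_coe, mem_outermost] at hA hB
  rcases subset_hole_or_disjoint_solidHull (hc A hA.1) (hc B hB.1) (hd hA.1 hB.1 hAB)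
    with ⟨H, hH, h⟩ | ⟨H, hH, h⟩ | h
  · exact (hAB (hB.2 A hA.1 (h.trans (subset_solidHull_of_mem_holes hH)))).elim
  · exact (hAB (hA.2 B hB.1 (h.trans (subset_solidHull_of_mem_holes hH))).symm).elim
  · exact h

open scoped Classical in
/-- The nesting of a finite disjoint family of connected sets: every member is outermost or lies in
exactly one hole of exactly one outermost member. Sums over the family split accordingly. -/
lemma sum_eq_sum_outermost (hc : ∀ A ∈ s, IsPreconnected A) (hne : ∀ A ∈ s, A.Nonempty)
    (hd : (s : Set (Set X)).PairwiseDisjoint id) (f : Set X → ℝ≥0∞) :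
    ∑ A ∈ s, f A = ∑ A ∈ outermost s,
      (f A + ∑' H : holes A, ∑ B ∈ s.filter (fun B => B ⊆ (H : Set X)), f B) := by
  have hcover : s = (outermost s).biUnion fun A => s.filter fun B => B ⊆ solidHull A := by
    ext B
    simp only [Finset.mem_biUnion, Finset.mem_filter]
    constructor
    · intro hB
      obtain ⟨A, hA, h⟩ := exists_mem_outermost hc hne hd hB
      exact ⟨A, hA, hB, h⟩
    · rintro ⟨A, -, hB, -⟩
      exact hB
  have hdisj : ((outermost s : Finset (Set X)) : Set (Set X)).PairwiseDisjoint
      fun A => s.filter fun B => B ⊆ solidHull A := by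
    intro A hA A' hA' hAA'
    refine Finset.disjoint_left.2 fun B hB hB' => ?_
    rw [Finset.mem_filter] at hB hB'
    obtain ⟨x, hx⟩ := hne B hB.1
    exact disjoint_left.1 (pairwiseDisjoint_solidHull_outermost hc hd hA hA' hAA') (hB.2 hx)
      (hB'.2 hx)
  conv_lhs => rw [hcover]
  rw [Finset.sum_biUnion hdisj]
  refine Finset.sum_congr rfl fun A hA => ?_
  have hAs := (mem_outermost.1 hA).1
  rw [← Finset.add_sum_erase _ f (Finset.mem_filter.2 ⟨hAs, subset_solidHull A⟩)]
  congr 1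
  set T := (s.filter fun B => B ⊆ solidHull A).erase A with hT
  have hTH : ∀ H : holes A, s.filter (fun B => B ⊆ (H : Set X)) =
      T.filter fun B => B ⊆ (H : Set X) := by
    intro H
    ext B
    simp only [hT, Finset.mem_filter, Finset.mem_erase]
    constructor
    · rintro ⟨hB, hBH⟩
      refine ⟨⟨?_, hB, hBH.trans (subset_solidHull_of_mem_holes H.2)⟩, hBH⟩
      rintro rfl
      obtain ⟨x, hx⟩ := hne B hB
      exact disjoint_left.1 (disjoint_of_mem_holes H.2) hx (hBH hx)
    · rintro ⟨⟨-, hB, -⟩, hBH⟩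
      exact ⟨hB, hBH⟩
  simp_rw [hTH, Finset.sum_filter]
  rw [Summable.tsum_finsetSum fun _ _ => ENNReal.summable]
  refine Finset.sum_congr rfl fun B hB => ?_
  simp only [hT, Finset.mem_filter, Finset.mem_erase] at hB
  obtain ⟨H, hH, hBH⟩ := exists_mem_holes_of_subset_solidHull (hc B hB.2.1) (hne B hB.2.1)
    (hd hB.2.1 hAs hB.1) hB.2.2
  rw [tsum_eq_single ⟨H, hH⟩, if_pos hBH]
  intro H' hH'
  refine if_neg fun h => hH' (Subtype.ext ?_)
  obtain ⟨x, hx⟩ := hne B hB.2.1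
  exact eq_of_mem_components H'.2.1 hH.1 ⟨x, h hx, hBH hx⟩

end Forest
end SolidTM

/-! ### Values of connected sets -/

namespace SolidTM
section ConnValue
variable {X : Type*} [TopologicalSpace X] {lam : Set X → ℝ≥0} {A B C D K U H : Set X}

lemma empty_mem_compactSolid [ConnectedSpace X] [NoncompactSpace X] :
    (∅ : Set X) ∈ CompactSolid := ⟨isCompact_empty, isSolid_empty⟩

namespace IsSolidSetFunction

lemma map_empty [ConnectedSpace X] [NoncompactSpace X] (h : IsSolidSetFunction lam) :
    lam ∅ = 0 := by
  simpa using h.partition 0 Fin.elim0 ∅ (fun i => i.elim0) (Or.inl empty_mem_compactSolid)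
    (fun i => i.elim0) (by simp)

lemma sum_le (h : IsSolidSetFunction lam) {ι : Type*} {t : Finset ι} {C : ι → Set X}
    (hC : ∀ i ∈ t, C i ∈ CompactSolid) (hD : D ∈ CompactSolid)
    (hd : (t : Set ι).PairwiseDisjoint C) (hCD : ∀ i ∈ t, C i ⊆ D) :
    ∑ i ∈ t, lam (C i) ≤ lam D := by
  have := h.superadd t.card (fun i => C (t.equivFin.symm i)) D
    (fun i => hC _ (t.equivFin.symm i).2) hD
    (fun i j hij => hd (t.equivFin.symm i).2 (t.equivFin.symm j).2 fun he =>
      hij (t.equivFin.symm.injective (Subtype.ext he)))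
    (iUnion_subset fun i => hCD _ (t.equivFin.symm i).2)
  rwa [Equiv.sum_comp t.equivFin.symm fun i : t => lam (C i),
    Finset.sum_coe_sort t fun i => lam (C i)] at this

lemma eq_sum (h : IsSolidSetFunction lam) {ι : Type*} {t : Finset ι} {A : ι → Set X}
    (hA : ∀ i ∈ t, A i ∈ BddSolid) (hD : D ∈ BddSolid)
    (hd : (t : Set ι).PairwiseDisjoint A) (hAD : D = ⋃ i ∈ t, A i) :
    lam D = ∑ i ∈ t, lam (A i) := by
  have := h.partition t.card (fun i => A (t.equivFin.symm i)) D
    (fun i => hA _ (t.equivFin.symm i).2) hD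
    (fun i j hij => hd (t.equivFin.symm i).2 (t.equivFin.symm j).2 fun he =>
      hij (t.equivFin.symm.injective (Subtype.ext he)))
    (by
      rw [hAD, t.equivFin.symm.surjective.iUnion_comp fun i : t => A i]
      exact biUnion_eq_iUnion (t : Set ι) fun i _ => A i)
  rwa [Equiv.sum_comp t.equivFin.symm fun i : t => lam (A i),
    Finset.sum_coe_sort t fun i => lam (A i)] at this

lemma mono_compactSolid (h : IsSolidSetFunction lam) (hC : C ∈ CompactSolid)
    (hD : D ∈ CompactSolid) (hCD : C ⊆ D) : lam C ≤ lam D := by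
  simpa using h.sum_le (t := {()}) (C := fun _ => C) (by simpa) hD (by simp) (by simpa)

lemma le_openSolid (h : IsSolidSetFunction lam) (hC : C ∈ CompactSolid)
    (hU : U ∈ OpenSolid) (hCU : C ⊆ U) : lam C ≤ lam U :=
  (h.inner_regular U hU).1 ⟨C, ⟨hC, hCU⟩, rfl⟩

lemma mono_openSolid (h : IsSolidSetFunction lam) (hU : U ∈ OpenSolid) (hD : D ∈ OpenSolid)
    (hUD : U ⊆ D) : lam U ≤ lam D := by
  refine (h.inner_regular U hU).2 ?_
  rintro _ ⟨C, ⟨hC, hCU⟩, rfl⟩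
  exact h.le_openSolid hC hD (hCU.trans hUD)

lemma exists_compactSolid_approx [ConnectedSpace X] [NoncompactSpace X]
    (h : IsSolidSetFunction lam) (hU : U ∈ OpenSolid) {ε : ℝ≥0} (hε : 0 < ε) :
    ∃ C ∈ CompactSolid, C ⊆ U ∧ lam U ≤ lam C + ε := by
  by_contra! hcon
  have h1 : lam U ≤ lam U - ε := by
    refine (h.inner_regular U hU).2 ?_
    rintro _ ⟨C, ⟨hC, hCU⟩, rfl⟩
    exact le_tsub_of_add_le_right (hcon C hC hCU).le
  have h2 := hcon ∅ empty_mem_compactSolid (empty_subset _)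
  exact h1.not_gt (tsub_lt_self (lt_of_le_of_lt zero_le h2) hε)

lemma exists_openSolid_approx (h : IsSolidSetFunction lam) (hK : K ∈ CompactSolid) {ε : ℝ≥0}
    (hε : 0 < ε) : ∃ U ∈ OpenSolid, K ⊆ U ∧ lam U ≤ lam K + ε := by
  -- if there were no open solid neighbourhood at all, `lam K + ε` would still be a lower bound
  by_contra! hcon
  have h1 : lam K + ε ≤ lam K := by
    refine (h.outer_regular K hK).2 ?_
    rintro _ ⟨U, ⟨hU, hKU⟩, rfl⟩
    exact (hcon U hU hKU).le
  exact h1.not_gt (lt_add_of_pos_right _ hε)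

lemma add_openSolid_le [ConnectedSpace X] [NoncompactSpace X] (h : IsSolidSetFunction lam)
    (hU : U ∈ OpenSolid) {c d : ℝ≥0∞}
    (hcd : ∀ C ∈ CompactSolid, C ⊆ U → c + lam C ≤ d) : c + lam U ≤ d := by
  refine ENNReal.le_of_forall_pos_le_add fun ε hε _ => ?_
  obtain ⟨C, hC, hCU, hle⟩ := h.exists_compactSolid_approx hU hε
  calc c + lam U ≤ c + (lam C + ε) := by gcongr; exact_mod_cast hle
    _ = c + lam C + ε := (add_assoc _ _ _).symm
    _ ≤ d + ε := by gcongr; exact hcd C hC hCU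

/-- To bound a sum of values on open solid sets it is enough to bound the values on compact solid
sets inside them. -/
lemma add_sum_openSolid_le [ConnectedSpace X] [NoncompactSpace X] (h : IsSolidSetFunction lam)
    {ι : Type*} {t : Finset ι} {U : ι → Set X} (hU : ∀ i ∈ t, U i ∈ OpenSolid) {c d : ℝ≥0∞}
    (hcd : ∀ C : ι → Set X, (∀ i ∈ t, C i ∈ CompactSolid ∧ C i ⊆ U i) →
      c + ∑ i ∈ t, (lam (C i) : ℝ≥0∞) ≤ d) : c + ∑ i ∈ t, (lam (U i) : ℝ≥0∞) ≤ d := by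
  classical
  induction t using Finset.induction_on generalizing c with
  | empty => simpa using hcd (fun _ => ∅) (by simp)
  | insert i t hi ih =>
    rw [Finset.sum_insert hi, ← add_assoc]
    refine ih (fun j hj => hU j (Finset.mem_insert_of_mem hj)) fun C hC => ?_
    rw [add_right_comm]
    refine h.add_openSolid_le (hU i (Finset.mem_insert_self _ _)) fun E hE hEU => ?_
    have hne : ∀ j ∈ t, j ≠ i := fun j hj hji => hi (hji ▸ hj)
    have := hcd (Function.update C i E) fun j hj => by
      rcases Finset.mem_insert.1 hj with rfl | hj
      · simpa using ⟨hE, hEU⟩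
      · simpa [Function.update_of_ne (hne j hj)] using hC j hj
    rw [Finset.sum_insert hi, Function.update_self, Finset.sum_congr rfl
      (fun j hj => by rw [Function.update_of_ne (hne j hj)])] at this
    rwa [add_assoc, add_comm (∑ j ∈ t, _) (lam E : ℝ≥0∞)]

end IsSolidSetFunction

/-- The value of the extension of `lam` on a connected set: the value of the solid hull minus the
values of the holes. (The subtraction is truncated, see
`IsSolidSetFunction.connValue_add_tsum_holes` for its exactness on compact connected sets.) -/
noncomputable def connValue (lam : Set X → ℝ≥0) (A : Set X) : ℝ≥0∞ :=
  lam (solidHull A) - ∑' B : holes A, (lam B : ℝ≥0∞)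

lemma connValue_of_isSolid (h : IsSolid A) : connValue lam A = lam A := by
  simp [connValue, solidHull_of_isSolid h, holes_of_isSolid h]

lemma lam_solidHull_le (lam : Set X → ℝ≥0) (A : Set X) :
    (lam (solidHull A) : ℝ≥0∞) ≤ connValue lam A + ∑' B : holes A, (lam B : ℝ≥0∞) :=
  le_tsub_add

namespace IsSolidSetFunction

lemma connValue_empty [ConnectedSpace X] [NoncompactSpace X] (h : IsSolidSetFunction lam) :
    connValue lam ∅ = 0 := by
  rw [connValue_of_isSolid isSolid_empty, h.map_empty, ENNReal.coe_zero]

variable [T2Space X] [LocallyCompactSpace X] [ConnectedSpace X] [LocallyConnectedSpace X]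
  [NoncompactSpace X]

lemma sum_le_openSolid (h : IsSolidSetFunction lam) {ι : Type*} {t : Finset ι} {C : ι → Set X}
    (hC : ∀ i ∈ t, C i ∈ CompactSolid) (hD : D ∈ OpenSolid)
    (hd : (t : Set ι).PairwiseDisjoint C) (hCD : ∀ i ∈ t, C i ⊆ D) :
    ∑ i ∈ t, lam (C i) ≤ lam D := by
  obtain ⟨E, hE, hCE, hED⟩ := exists_compactSolid_between
    (t.isCompact_biUnion fun i hi => (hC i hi).1) hD.1 hD.2.2 (iUnion₂_subset hCD)
  exact (h.sum_le hC hE hd fun i hi => (subset_biUnion_of_mem (u := C) hi).trans hCE).trans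
    (h.le_openSolid hE hD hED)

lemma tsum_holes_le (h : IsSolidSetFunction lam) (hK : K ∈ CompactConn) :
    ∑' B : holes K, (lam B : ℝ≥0∞) ≤ lam (solidHull K) := by
  rw [ENNReal.tsum_eq_iSup_sum]
  refine iSup_le fun t => ?_
  rw [← zero_add (∑ B ∈ t, (lam B : ℝ≥0∞))]
  refine h.add_sum_openSolid_le (U := fun B : holes K => (B : Set X))
    (fun B _ => mem_openSolid_of_mem_holes hK B.2) fun C hC => ?_
  rw [zero_add]
  have := h.sum_le (fun i hi => (hC i hi).1) (solidHull_mem_compactSolid hK)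
    (fun B hB B' hB' hBB' => (disjoint_of_mem_components B.2.1 B'.2.1
      fun he => hBB' (Subtype.ext he)).mono (hC B hB).2 (hC B' hB').2)
    fun B hB => (hC B hB).2.trans (subset_solidHull_of_mem_holes B.2)
  exact_mod_cast this

lemma connValue_add_tsum_holes (h : IsSolidSetFunction lam) (hK : K ∈ CompactConn) :
    connValue lam K + ∑' B : holes K, (lam B : ℝ≥0∞) = lam (solidHull K) :=
  tsub_add_cancel_of_le (h.tsum_holes_le hK)

/-- Superadditivity: disjoint compact connected subsets of an open solid set have a total value of
at most the value of this set. By induction on the number of sets: each hole of an outermost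
set is an open solid set containing fewer of them. -/
lemma sum_connValue_le (h : IsSolidSetFunction lam) {s : Finset (Set X)} (hD : D ∈ OpenSolid)
    (hs : ∀ K ∈ s, K ∈ CompactConn ∧ K ⊆ D) (hd : (s : Set (Set X)).PairwiseDisjoint id) :
    ∑ K ∈ s, connValue lam K ≤ lam D := by
  classical
  induction hn : s.card using Nat.strong_induction_on generalizing s D with
  | _ n ih =>
  by_cases hemp : ∅ ∈ s
  · rw [← Finset.add_sum_erase _ _ hemp, h.connValue_empty, zero_add]
    refine ih _ (hn ▸ Finset.card_erase_lt_of_mem hemp) hD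
      (fun K hK => hs K (Finset.mem_of_mem_erase hK)) (hd.subset ?_) rfl
    exact Finset.coe_subset.2 (Finset.erase_subset _ _)
  have hne : ∀ A ∈ s, A.Nonempty := fun A hA => nonempty_iff_ne_empty.2 fun he => hemp (he ▸ hA)
  have hc : ∀ A ∈ s, IsPreconnected A := fun A hA => (hs A hA).1.2
  rw [sum_eq_sum_outermost hc hne hd]
  have hout : ∀ A ∈ outermost s, A ∈ s := fun A hA => (mem_outermost.1 hA).1
  calc _ ≤ ∑ A ∈ outermost s, (lam (solidHull A) : ℝ≥0∞) := by
        refine Finset.sum_le_sum fun A hA => ?_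
        rw [← h.connValue_add_tsum_holes (hs A (hout A hA)).1]
        gcongr with H
        have hlt : (s.filter fun B => B ⊆ (H : Set X)).card < n := by
          rw [← hn]
          refine Finset.card_lt_card (Finset.filter_ssubset.2 ⟨A, hout A hA, fun hAH => ?_⟩)
          obtain ⟨x, hx⟩ := hne A (hout A hA)
          exact disjoint_left.1 (disjoint_of_mem_holes H.2) hx (hAH hx)
        refine ih _ hlt (mem_openSolid_of_mem_holes (hs A (hout A hA)).1 H.2) (fun K hK => ?_)
          (hd.subset (Finset.coe_subset.2 (Finset.filter_subset _ _))) rfl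
        rw [Finset.mem_filter] at hK
        exact ⟨(hs K hK.1).1, hK.2⟩
    _ ≤ lam D := by
        have := h.sum_le_openSolid (fun A hA => solidHull_mem_compactSolid (hs A (hout A hA)).1) hD
          (pairwiseDisjoint_solidHull_outermost hc hd)
          fun A hA => solidHull_subset hD.2.2 (hs A (hout A hA)).2
        exact_mod_cast this

/-- If a solid set is partitioned into finitely many compact connected and bounded semi-solid sets
then its value is at most the sum of their values. By induction on the number of sets: the solid
hulls of the outermost sets form a partition of the given set, and each hole is a solid set
partitioned into fewer sets. -/
lemma le_sum_connValue (h : IsSolidSetFunction lam) {s : Finset (Set X)} (hD : D ∈ BddSolid)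
    (hs : ∀ A ∈ s, A ∈ BddSemiSolid ∪ CompactConn) (hne : ∀ A ∈ s, A.Nonempty)
    (hd : (s : Set (Set X)).PairwiseDisjoint id) (hsD : ⋃₀ (s : Set (Set X)) = D) :
    lam D ≤ ∑ A ∈ s, connValue lam A := by
  classical
  induction hn : s.card using Nat.strong_induction_on generalizing s D with
  | _ n ih =>
  have hc : ∀ A ∈ s, IsPreconnected A :=
    fun A hA => isPreconnected_of_mem_bddSemiSolid_union (hs A hA)
  have hsol := isSolid_of_mem_BddSolid hD
  have hsub : ∀ A ∈ s, A ⊆ D := fun A hA => hsD ▸ subset_sUnion_of_mem (Finset.mem_coe.2 hA)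
  rw [sum_eq_sum_outermost hc hne hd]
  have hout : ∀ A ∈ outermost s, A ∈ s := fun A hA => (mem_outermost.1 hA).1
  calc (lam D : ℝ≥0∞) = ∑ A ∈ outermost s, (lam (solidHull A) : ℝ≥0∞) := by
        rw [h.eq_sum (fun A hA => solidHull_mem_bddSolid (hs A (hout A hA))) hD
          (pairwiseDisjoint_solidHull_outermost hc hd) ?_]
        · push_cast
          rfl
        · apply Subset.antisymm
          · rw [← hsD]
            refine sUnion_subset fun A hA => ?_
            obtain ⟨B, hB, hAB⟩ := exists_mem_outermost hc hne hd hA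
            exact hAB.trans (subset_biUnion_of_mem (u := solidHull) hB)
          · exact iUnion₂_subset fun A hA => solidHull_subset hsol (hsub A (hout A hA))
    _ ≤ _ := by
        refine Finset.sum_le_sum fun A hA => (lam_solidHull_le lam A).trans ?_
        gcongr with H
        have hlt : (s.filter fun B => B ⊆ (H : Set X)).card < n := by
          rw [← hn]
          refine Finset.card_lt_card (Finset.filter_ssubset.2 ⟨A, hout A hA, fun hAH => ?_⟩)
          obtain ⟨x, hx⟩ := hne A (hout A hA)
          exact disjoint_left.1 (disjoint_of_mem_holes H.2) hx (hAH hx)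
        refine ih _ hlt (holes_subset_bddSolid (hs A (hout A hA)) H.2)
          (fun B hB => hs B (Finset.mem_filter.1 hB).1)
          (fun B hB => hne B (Finset.mem_filter.1 hB).1)
          (hd.subset (Finset.coe_subset.2 (Finset.filter_subset _ _))) ?_ rfl
        apply Subset.antisymm
        · exact sUnion_subset fun B hB => (Finset.mem_filter.1 (Finset.mem_coe.1 hB)).2
        · intro x hx
          have hxD : x ∈ D := solidHull_subset hsol (hsub A (hout A hA))
            (subset_solidHull_of_mem_holes H.2 hx)
          rw [← hsD] at hxD
          obtain ⟨B, hB, hxB⟩ := hxD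
          refine ⟨B, Finset.mem_coe.2 (Finset.mem_filter.2 ⟨hB, ?_⟩), hxB⟩
          have hBA : B ≠ A := by
            rintro rfl
            exact disjoint_left.1 (disjoint_of_mem_holes H.2) hxB hx
          exact subset_of_mem_components_of_inter H.2.1 (hc B hB)
            (subset_compl_iff_disjoint_right.2 (hd hB (hout A hA) hBA)) ⟨x, hxB, hx⟩

end IsSolidSetFunction
end ConnValue
end SolidTM

/-! ### The extension and its superadditivity -/

namespace SolidTM
section Extension
variable {X : Type*} [TopologicalSpace X] {lam : Set X → ℝ≥0} {A B C D G K L U V W : Set X}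
  {s t : Finset (Set X)}

/-- A finite family of pairwise disjoint compact connected subsets of `A`. -/
def IsPacking (s : Finset (Set X)) (A : Set X) : Prop :=
  (∀ K ∈ s, K ∈ CompactConn ∧ K ⊆ A) ∧ (s : Set (Set X)).PairwiseDisjoint id

/-- The value of the extension of `lam` on an open set: the supremum, over all finite families of
disjoint compact connected subsets, of the sum of their values. -/
noncomputable def openValue (lam : Set X → ℝ≥0) (U : Set X) : ℝ≥0∞ :=
  ⨆ s ∈ {s : Finset (Set X) | IsPacking s U}, ∑ K ∈ s, connValue lam K

/-- The extension of `lam`, on an arbitrary set the infimum of the values of its open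
neighbourhoods. -/
noncomputable def extension (lam : Set X → ℝ≥0) (A : Set X) : ℝ≥0∞ :=
  ⨅ U ∈ {U : Set X | IsOpen U ∧ A ⊆ U}, openValue lam U

lemma IsPacking.mono (h : IsPacking s A) (hAB : A ⊆ B) : IsPacking s B :=
  ⟨fun K hK => ⟨(h.1 K hK).1, (h.1 K hK).2.trans hAB⟩, h.2⟩

lemma IsPacking.subset (h : IsPacking s A) (hts : t ⊆ s) : IsPacking t A :=
  ⟨fun K hK => h.1 K (hts hK), h.2.subset (Finset.coe_subset.2 hts)⟩

lemma isPacking_singleton (hK : K ∈ CompactConn) (h : K ⊆ A) : IsPacking {K} A :=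
  ⟨by simp [hK, h], by simp⟩

lemma IsPacking.isCompact_sUnion (h : IsPacking s A) : IsCompact (⋃₀ (s : Set (Set X))) :=
  s.finite_toSet.isCompact_sUnion fun K hK => (h.1 K hK).1.1

lemma IsPacking.sUnion_subset (h : IsPacking s A) : ⋃₀ (s : Set (Set X)) ⊆ A :=
  Set.sUnion_subset fun K hK => (h.1 K hK).2

open scoped Classical in
lemma IsPacking.union (hs : IsPacking s A) (ht : IsPacking t B) (h : Disjoint A B) :
    IsPacking (s ∪ t) (A ∪ B) := by
  refine ⟨fun K hK => ?_, ?_⟩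
  · rcases Finset.mem_union.1 hK with hK | hK
    · exact ⟨(hs.1 K hK).1, (hs.1 K hK).2.trans subset_union_left⟩
    · exact ⟨(ht.1 K hK).1, (ht.1 K hK).2.trans subset_union_right⟩
  · rw [Finset.coe_union, pairwiseDisjoint_union]
    exact ⟨hs.2, ht.2, fun K hK L hL _ => h.mono (hs.1 K hK).2 (ht.1 L hL).2⟩

lemma IsPacking.sum_le_openValue (h : IsPacking s U) : ∑ K ∈ s, connValue lam K ≤ openValue lam U :=
  le_iSup₂_of_le (f := fun (s : Finset (Set X)) (_ : s ∈ {s : Finset (Set X) | IsPacking s U}) =>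
    ∑ K ∈ s, connValue lam K) s h le_rfl

lemma connValue_le_openValue (hK : K ∈ CompactConn) (h : K ⊆ U) :
    connValue lam K ≤ openValue lam U := by
  simpa using (isPacking_singleton hK h).sum_le_openValue (lam := lam)

lemma openValue_mono (h : U ⊆ V) : openValue lam U ≤ openValue lam V :=
  iSup₂_le fun _ hs => (IsPacking.mono hs h).sum_le_openValue

lemma extension_le_openValue (hU : IsOpen U) (h : A ⊆ U) : extension lam A ≤ openValue lam U :=
  iInf₂_le U ⟨hU, h⟩

lemma extension_of_isOpen (hU : IsOpen U) : extension lam U = openValue lam U :=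
  le_antisymm (extension_le_openValue hU Subset.rfl) (le_iInf₂ fun _ hV => openValue_mono hV.2)

lemma extension_mono (h : A ⊆ B) : extension lam A ≤ extension lam B :=
  le_iInf₂ fun _ hU => extension_le_openValue hU.1 (h.trans hU.2)

lemma IsPacking.sum_le_extension (h : IsPacking s A) :
    ∑ K ∈ s, connValue lam K ≤ extension lam A :=
  le_iInf₂ fun _ hU => (h.mono hU.2).sum_le_openValue

lemma exists_isOpen_openValue_le (hA : extension lam A ≠ ∞) {ε : ℝ≥0} (hε : 0 < ε) :
    ∃ U, IsOpen U ∧ A ⊆ U ∧ openValue lam U ≤ extension lam A + ε := by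
  have : extension lam A < extension lam A + ε :=
    ENNReal.lt_add_right hA (ENNReal.coe_ne_zero.2 hε.ne')
  simp only [extension, iInf_lt_iff] at this
  obtain ⟨U, hU, hlt⟩ := this
  exact ⟨U, hU.1, hU.2, hlt.le⟩

namespace IsSolidSetFunction

lemma sum_union [ConnectedSpace X] [NoncompactSpace X] [DecidableEq (Set X)]
    (h : IsSolidSetFunction lam) (hs : IsPacking s A)
    (ht : IsPacking t B) (hAB : Disjoint A B) :
    ∑ K ∈ s ∪ t, connValue lam K = ∑ K ∈ s, connValue lam K + ∑ K ∈ t, connValue lam K := by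
  rw [← Finset.sum_union_inter, Finset.sum_eq_zero (s := s ∩ t), add_zero]
  intro K hK
  rw [Finset.mem_inter] at hK
  have : K = ∅ := by
    have := hAB.mono (hs.1 K hK.1).2 (ht.1 K hK.2).2
    rwa [disjoint_self] at this
  rw [this, h.connValue_empty]

variable [ConnectedSpace X] [NoncompactSpace X]

lemma openValue_add_le (h : IsSolidSetFunction lam) (hUV : Disjoint U V) :
    openValue lam U + openValue lam V ≤ openValue lam (U ∪ V) := by
  classical
  refine ENNReal.biSup_add_biSup_le' ⟨∅, by simp [IsPacking]⟩ ⟨∅, by simp [IsPacking]⟩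
    fun s hs t ht => ?_
  rw [← h.sum_union hs ht hUV]
  exact (IsPacking.union hs ht hUV).sum_le_openValue

lemma openValue_sdiff_add_sum_le (h : IsSolidSetFunction lam) (hs : IsPacking s W) :
    openValue lam (W \ ⋃₀ (s : Set (Set X))) + ∑ K ∈ s, connValue lam K ≤ openValue lam W := by
  have h1 : IsPacking s (⋃₀ (s : Set (Set X))) :=
    ⟨fun K hK => ⟨(hs.1 K hK).1, subset_sUnion_of_mem (Finset.mem_coe.2 hK)⟩, hs.2⟩
  calc _ ≤ openValue lam (W \ ⋃₀ (s : Set (Set X))) + openValue lam (⋃₀ (s : Set (Set X))) := by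
        gcongr
        exact h1.sum_le_openValue
    _ ≤ _ := h.openValue_add_le disjoint_sdiff_left
    _ ≤ _ := openValue_mono (union_subset sdiff_subset hs.sUnion_subset)

lemma openValue_union (h : IsSolidSetFunction lam) (hU : IsOpen U) (hV : IsOpen V)
    (hUV : Disjoint U V) : openValue lam (U ∪ V) = openValue lam U + openValue lam V := by
  classical
  refine le_antisymm (iSup₂_le fun s hs => ?_) (h.openValue_add_le hUV)
  rw [← Finset.sum_filter_add_sum_filter_not s fun K => K ⊆ U]
  refine add_le_add (IsPacking.sum_le_openValue ⟨fun K hK => ?_, (hs.subset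
    (Finset.filter_subset _ _)).2⟩) (IsPacking.sum_le_openValue ⟨fun K hK => ?_, (hs.subset
    (Finset.filter_subset _ _)).2⟩)
  · rw [Finset.mem_filter] at hK
    exact ⟨(hs.1 K hK.1).1, hK.2⟩
  · rw [Finset.mem_filter] at hK
    exact ⟨(hs.1 K hK.1).1, ((hs.1 K hK.1).1.2.subset_or_subset hU hV hUV
      (hs.1 K hK.1).2).resolve_left hK.2⟩

lemma extension_add_openValue_sdiff_le [T2Space X] (h : IsSolidSetFunction lam) (hW : IsOpen W)
    (hKW : K ⊆ W) :
    extension lam K + openValue lam (W \ K) ≤ openValue lam W := by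
  rw [openValue, ENNReal.add_biSup' ⟨∅, by simp [IsPacking]⟩]
  refine iSup₂_le fun s hs => le_trans ?_
    (h.openValue_sdiff_add_sum_le (IsPacking.mono hs sdiff_subset))
  gcongr
  refine extension_le_openValue (hW.sdiff (IsPacking.isCompact_sUnion hs).isClosed) fun x hx => ?_
  exact ⟨hKW hx, fun hx' => (IsPacking.sUnion_subset hs hx').2 hx⟩

variable [T2Space X] [LocallyCompactSpace X] [LocallyConnectedSpace X]

lemma openValue_of_mem_openSolid (h : IsSolidSetFunction lam) (hU : U ∈ OpenSolid) :
    openValue lam U = lam U := by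
  apply le_antisymm
  · exact iSup₂_le fun s hs => h.sum_connValue_le hU hs.1 hs.2
  · rw [← zero_add (lam U : ℝ≥0∞)]
    refine h.add_openSolid_le hU fun C hC hCU => ?_
    rw [zero_add, ← connValue_of_isSolid hC.2]
    exact connValue_le_openValue ⟨hC.1, hC.2.1⟩ hCU

/-- On a compact connected set `K` the extension has the expected value: a small open solid
neighbourhood of the solid hull, minus large compact solid subsets of finitely many holes, is a
neighbourhood of `K` of almost this value. -/
lemma extension_of_mem_compactConn (h : IsSolidSetFunction lam) (hK : K ∈ CompactConn) :
    extension lam K = connValue lam K := by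
  classical
  refine le_antisymm ?_ (by
    simpa using (isPacking_singleton hK Subset.rfl).sum_le_extension (lam := lam))
  refine ENNReal.le_sub_of_add_le_right
    (ne_top_of_le_ne_top ENNReal.coe_ne_top (h.tsum_holes_le hK)) ?_
  refine ENNReal.le_of_forall_pos_le_add fun ε hε _ => ?_
  obtain ⟨U, hU, hKU, hle⟩ := h.exists_openSolid_approx (solidHull_mem_compactSolid hK) hε
  rw [ENNReal.tsum_eq_iSup_sum, ENNReal.add_iSup]
  refine iSup_le fun t => ?_
  refine h.add_sum_openSolid_le (U := fun B : holes K => (B : Set X))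
    (fun B _ => mem_openSolid_of_mem_holes hK B.2) fun C hC => ?_
  have hdisj : (t : Set (holes K)).PairwiseDisjoint C := fun B hB B' hB' hBB' =>
    (disjoint_of_mem_components B.2.1 B'.2.1 fun he => hBB' (Subtype.ext he)).mono
      (hC B hB).2 (hC B' hB').2
  have hsum : ∑ L ∈ t.image C, connValue lam L = ∑ B ∈ t, (lam (C B) : ℝ≥0∞) := by
    rw [Finset.sum_image_of_disjoint h.connValue_empty hdisj]
    exact Finset.sum_congr rfl fun B hB => connValue_of_isSolid (hC B hB).1.2
  have hpack : IsPacking (t.image C) U := by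
    constructor
    · intro L hL
      obtain ⟨B, hB, rfl⟩ := Finset.mem_image.1 hL
      exact ⟨⟨(hC B hB).1.1, (hC B hB).1.2.1⟩,
        ((hC B hB).2.trans (subset_solidHull_of_mem_holes B.2)).trans hKU⟩
    · rw [Finset.coe_image]
      exact hdisj.image
  have hsub : K ⊆ U \ ⋃₀ (t.image C : Set (Set X)) := by
    refine fun x hx => ⟨hKU (subset_solidHull K hx), ?_⟩
    rintro ⟨L, hL, hxL⟩
    obtain ⟨B, hB, rfl⟩ := Finset.mem_image.1 (Finset.mem_coe.1 hL)
    exact disjoint_left.1 (disjoint_of_mem_holes B.2) hx ((hC B hB).2 hxL)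
  calc extension lam K + ∑ B ∈ t, (lam (C B) : ℝ≥0∞)
      ≤ openValue lam (U \ ⋃₀ (t.image C : Set (Set X))) + ∑ L ∈ t.image C, connValue lam L := by
        rw [hsum]
        gcongr
        exact extension_le_openValue (hU.1.sdiff hpack.isCompact_sUnion.isClosed) hsub
    _ ≤ openValue lam U := h.openValue_sdiff_add_sum_le hpack
    _ = lam U := h.openValue_of_mem_openSolid hU
    _ ≤ lam (solidHull K) + ε := by exact_mod_cast hle

lemma extension_of_mem_bddSolid (h : IsSolidSetFunction lam) (hA : A ∈ BddSolid) :
    extension lam A = lam A := by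
  rcases hA with hA | hA
  · rw [h.extension_of_mem_compactConn ⟨hA.1, hA.2.1⟩, connValue_of_isSolid hA.2]
  · rw [extension_of_isOpen hA.1, h.openValue_of_mem_openSolid hA]

lemma extension_lt_top (h : IsSolidSetFunction lam) (hK : IsCompact K) :
    extension lam K < ∞ := by
  obtain ⟨C, hC, hKC⟩ := exists_compactSolid_superset hK
  refine (extension_mono hKC).trans_lt ?_
  rw [h.extension_of_mem_bddSolid (Or.inl hC)]
  exact ENNReal.coe_lt_top

lemma extension_union_of_isCompact (h : IsSolidSetFunction lam) (hK : IsCompact K)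
    (hL : IsCompact L) (hd : Disjoint K L) :
    extension lam (K ∪ L) = extension lam K + extension lam L := by
  obtain ⟨U, V, hU, hV, hKU, hLV, hUV⟩ := SeparatedNhds.of_isCompact_isCompact hK hL hd
  apply le_antisymm
  · refine ENNReal.le_of_forall_pos_le_add fun ε hε _ => ?_
    obtain ⟨U', hU', hKU', hle⟩ := exists_isOpen_openValue_le (h.extension_lt_top hK).ne
      (half_pos hε)
    obtain ⟨V', hV', hLV', hle'⟩ := exists_isOpen_openValue_le (h.extension_lt_top hL).ne
      (half_pos hε)
    calc extension lam (K ∪ L) ≤ openValue lam (U' ∩ U ∪ V' ∩ V) :=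
          extension_le_openValue ((hU'.inter hU).union (hV'.inter hV))
            (union_subset_union (subset_inter hKU' hKU) (subset_inter hLV' hLV))
      _ = openValue lam (U' ∩ U) + openValue lam (V' ∩ V) :=
          h.openValue_union (hU'.inter hU) (hV'.inter hV)
            (hUV.mono inter_subset_right inter_subset_right)
      _ ≤ openValue lam U' + openValue lam V' :=
          add_le_add (openValue_mono inter_subset_left) (openValue_mono inter_subset_left)
      _ ≤ (extension lam K + (ε / 2 : ℝ≥0)) + (extension lam L + (ε / 2 : ℝ≥0)) :=
          add_le_add hle hle'
      _ = extension lam K + extension lam L + ε := by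
          rw [add_add_add_comm, ← ENNReal.coe_add, add_halves]
  · refine le_iInf₂ fun W hW => ?_
    calc extension lam K + extension lam L ≤ openValue lam (U ∩ W) + openValue lam (V ∩ W) :=
          add_le_add
            (extension_le_openValue (hU.inter hW.1)
              (subset_inter hKU (subset_union_left.trans hW.2)))
            (extension_le_openValue (hV.inter hW.1)
              (subset_inter hLV (subset_union_right.trans hW.2)))
      _ ≤ openValue lam (U ∩ W ∪ V ∩ W) :=
          h.openValue_add_le (hUV.mono inter_subset_left inter_subset_left)
      _ ≤ openValue lam W :=
          openValue_mono (union_subset inter_subset_right inter_subset_right)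

lemma extension_sUnion_of_isCompact (h : IsSolidSetFunction lam) (hs : ∀ K ∈ s, IsCompact K)
    (hd : (s : Set (Set X)).PairwiseDisjoint id) :
    extension lam (⋃₀ (s : Set (Set X))) = ∑ K ∈ s, extension lam K := by
  classical
  induction s using Finset.induction_on with
  | empty =>
    simp [h.extension_of_mem_bddSolid (Or.inl empty_mem_compactSolid), h.map_empty]
  | insert K s hK ih =>
    rw [Finset.coe_insert] at hd ⊢
    rw [sUnion_insert, Finset.sum_insert hK, ← ih (fun L hL => hs L (Finset.mem_insert_of_mem hL))
      (hd.subset (subset_insert _ _)), h.extension_union_of_isCompact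
      (hs K (Finset.mem_insert_self _ _))
      (s.finite_toSet.isCompact_sUnion fun L hL => hs L (Finset.mem_insert_of_mem hL))]
    rw [disjoint_sUnion_right]
    intro L hL
    exact hd (mem_insert _ _) (mem_insert_of_mem _ hL) fun he => hK (he ▸ hL)

end IsSolidSetFunction
end Extension
end SolidTM

/-! ### Subadditivity of the extension -/

namespace SolidTM
section Additivity
variable {X : Type*} [TopologicalSpace X] {lam : Set X → ℝ≥0} {A B C D G K L P S U V W : Set X}
  {s t : Finset (Set X)}

lemma ennreal_sum_union_le {ι : Type*} [DecidableEq ι] (s t : Finset ι) (f : ι → ℝ≥0∞) :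
    ∑ i ∈ s ∪ t, f i ≤ ∑ i ∈ s, f i + ∑ i ∈ t, f i := by
  rw [← Finset.sum_union_inter]
  exact le_self_add

lemma finite_components_compl_of_mem_components (hS : (components S).Finite)
    (hS' : (components Sᶜ).Finite) (hC : C ∈ components S) : (components Cᶜ).Finite := by
  have : Cᶜ = ⋃₀ (components S \ {C} ∪ components Sᶜ) := by
    ext x
    constructor
    · intro hx
      by_cases hxS : x ∈ S
      · obtain ⟨B, hB, hxB⟩ := exists_mem_components hxS
        exact ⟨B, Or.inl ⟨hB, fun h => hx (h ▸ hxB)⟩, hxB⟩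
      · obtain ⟨B, hB, hxB⟩ := exists_mem_components (S := Sᶜ) hxS
        exact ⟨B, Or.inr hB, hxB⟩
    · rintro ⟨B, ⟨hB, hBC⟩ | hB, hxB⟩ hxC
      · exact hBC (eq_of_mem_components hB hC ⟨x, hxB, hxC⟩)
      · exact subset_of_mem_components hB hxB (subset_of_mem_components hC hxC)
  rw [this]
  refine finite_components_sUnion ((hS.subset sdiff_subset).union hS') ?_
  rintro B (hB | hB)
  · exact isPreconnected_of_mem_components hB.1
  · exact isPreconnected_of_mem_components hB

lemma mem_bddSemiSolid_union_of_mem_holes [T2Space X] [ConnectedSpace X]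
    [LocallyConnectedSpace X] [NoncompactSpace X] (hA : A ∈ BddSemiSolid ∪ CompactConn)
    (hB : B ∈ holes A) : B ∈ BddSemiSolid ∪ CompactConn := by
  have hAc := isPreconnected_of_mem_bddSemiSolid_union hA
  have hne : A.Nonempty := by
    rw [nonempty_iff_ne_empty]
    rintro rfl
    rw [holes_of_isSolid isSolid_empty] at hB
    exact hB
  refine Or.inl ⟨⟨isPreconnected_of_mem_components hB.1, (finite_singleton _).subset
    (components_of_isPreconnected (isPreconnected_compl_of_mem_components hAc hne hB.1))⟩, ?_⟩
  exact (holes_subset_bddSolid hA hB).imp (fun h => h.1) fun h => ⟨h.1, h.2.1⟩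

lemma exists_mem_holes_of_frontier_subset [T2Space X] {N : Set X} {x : X} (hN : IsCompact N)
    (hNK : frontier N ⊆ K) (hx : x ∈ interior N) (hxK : x ∉ K) :
    ∃ H ∈ holes K, x ∈ H := by
  obtain ⟨H, hH, hxH⟩ := exists_mem_components (S := Kᶜ) hxK
  refine ⟨H, ⟨hH, (isBdd_of_isCompact hN).mono ?_⟩, hxH⟩
  rcases subset_interior_or_of_disjoint_frontier (isPreconnected_of_mem_components hH)
    (disjoint_compl_left.mono (subset_of_mem_components hH) hNK) with h | h
  · exact h.trans interior_subset
  · exact (h hxH (subset_closure (interior_subset hx))).elim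

namespace IsSolidSetFunction

lemma sum_openValue_le [ConnectedSpace X] [NoncompactSpace X] (h : IsSolidSetFunction lam)
    (hd : (s : Set (Set X)).PairwiseDisjoint id) :
    ∑ G ∈ s, openValue lam G ≤ openValue lam (⋃₀ (s : Set (Set X))) := by
  classical
  induction s using Finset.induction_on with
  | empty => simp
  | insert G s hG ih =>
    rw [Finset.coe_insert] at hd ⊢
    rw [Finset.sum_insert hG, sUnion_insert]
    refine le_trans ?_ (h.openValue_add_le ?_)
    · gcongr
      exact ih (hd.subset (subset_insert _ _))
    · rw [disjoint_sUnion_right]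
      intro L hL
      exact hd (mem_insert _ _) (mem_insert_of_mem _ hL) fun he => hG (he ▸ hL)

variable [T2Space X] [LocallyCompactSpace X] [ConnectedSpace X] [LocallyConnectedSpace X]
  [NoncompactSpace X]

/-- If the complement of a compact connected set has finitely many components, the set together with
its holes is a finite partition of its solid hull, so partitions of the set can be treated as
partitions of a solid set. -/
lemma connValue_le_sum (h : IsSolidSetFunction lam) (hC : C ∈ CompactConn)
    (hCf : (components Cᶜ).Finite) (hs : ∀ A ∈ s, A ∈ BddSemiSolid ∪ CompactConn)
    (hne : ∀ A ∈ s, A.Nonempty) (hd : (s : Set (Set X)).PairwiseDisjoint id)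
    (hsC : ⋃₀ (s : Set (Set X)) = C) : connValue lam C ≤ ∑ A ∈ s, connValue lam A := by
  classical
  have hfin : (holes C).Finite := hCf.subset (holes_subset_components C)
  have hsub : ∀ A ∈ s, A ⊆ C := fun A hA => hsC ▸ subset_sUnion_of_mem (Finset.mem_coe.2 hA)
  have htsum : ∑' B : holes C, (lam B : ℝ≥0∞) = ∑ B ∈ hfin.toFinset, (lam B : ℝ≥0∞) := by
    have := Finset.tsum_subtype' hfin.toFinset fun B => (lam B : ℝ≥0∞)
    rwa [hfin.coe_toFinset] at this
  rw [connValue, tsub_le_iff_right, htsum]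
  have hle := h.le_sum_connValue (s := s ∪ hfin.toFinset)
    (solidHull_mem_bddSolid (Or.inr hC)) ?_ ?_ ?_ ?_
  · refine hle.trans ((ennreal_sum_union_le _ _ _).trans ?_)
    gcongr with B hB
    rw [connValue_of_isSolid (isSolid_of_mem_holes hC.2 (hfin.mem_toFinset.1 hB))]
  · intro A hA
    rcases Finset.mem_union.1 hA with hA | hA
    · exact hs A hA
    · exact mem_bddSemiSolid_union_of_mem_holes (Or.inr hC) (hfin.mem_toFinset.1 hA)
  · intro A hA
    rcases Finset.mem_union.1 hA with hA | hA
    · exact hne A hA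
    · exact nonempty_of_mem_components (hfin.mem_toFinset.1 hA).1
  · rw [Finset.coe_union, hfin.coe_toFinset, pairwiseDisjoint_union]
    refine ⟨hd, (pairwiseDisjoint_components Cᶜ).subset (holes_subset_components C), ?_⟩
    exact fun A hA B hB _ => (disjoint_of_mem_holes hB).mono_left (hsub A hA)
  · rw [Finset.coe_union, hfin.coe_toFinset, sUnion_union, hsC]
    rfl

/-- The value of a bounded open semi-solid set `G` is approximated from inside by compact connected
sets: take one whose solid hull contains most of the solid hull of `G` and which contains the
frontiers of small neighbourhoods of the holes of `G`, and fill in those of its holes which lie in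
`G`. Each remaining hole contains a hole of `G` and lies in a small neighbourhood of it. -/
lemma connValue_le_openValue_of_isOpen (h : IsSolidSetFunction lam) (hG : IsOpen G)
    (hb : IsBdd G) (hGf : IsSemiSolid G) :
    connValue lam G ≤ openValue lam G := by
  rcases G.eq_empty_or_nonempty with rfl | hGne
  · simp [h.connValue_empty]
  have hfin : (holes G).Finite := hGf.2.subset (holes_subset_components G)
  have hhull := solidHull_mem_openSolid hG hb hGf
  have hcompact : ∀ B ∈ holes G, B ∈ CompactSolid :=
    fun B hB => mem_compactSolid_of_mem_holes hG hGf.1 hB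
  rw [connValue, tsub_le_iff_right]
  refine ENNReal.le_of_forall_pos_le_add fun ε hε _ => ?_
  have : Finite (holes G) := hfin
  obtain ⟨δ, hδ, hδε⟩ := ENNReal.exists_pos_sum_of_countable
    (ENNReal.coe_ne_zero.2 (half_pos hε).ne') (holes G)
  choose U hU hBU hUle using fun B : holes G =>
    h.exists_openSolid_approx (hcompact B B.2) (hδ B)
  have hN : ∀ B : holes G, ∃ N, IsCompact N ∧ (B : Set X) ⊆ interior N ∧ N ⊆ U B ∧
      frontier N ⊆ G := by
    intro B
    have hclosed : IsClosed (⋃₀ (holes G \ {(B : Set X)})) := by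
      rw [sUnion_eq_biUnion]
      exact (hfin.subset sdiff_subset).isClosed_biUnion fun B' hB' =>
        (hcompact B' hB'.1).1.isClosed
    obtain ⟨N, hN, hBN, hNU⟩ := exists_compact_between (hcompact B B.2).1
      (((hU B).1.inter hhull.1).inter hclosed.isOpen_compl) (subset_inter (subset_inter (hBU B)
        (subset_solidHull_of_mem_holes B.2)) (by
          rintro x hx ⟨B', ⟨hB', hne⟩, hxB'⟩
          exact hne (eq_of_mem_components hB'.1 B.2.1 ⟨x, hxB', hx⟩)))
    refine ⟨N, hN, hBN, fun x hx => (hNU hx).1.1, fun x hx => ?_⟩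
    have hxN := hNU (hN.isClosed.frontier_subset hx)
    rcases hxN.1.2 with hxG | ⟨B', hB', hxB'⟩
    · exact hxG
    · exfalso
      by_cases hBB' : B' = B
      · exact hx.2 (hBN (hBB' ▸ hxB'))
      · exact hxN.2 ⟨B', ⟨hB', hBB'⟩, hxB'⟩
  choose N hN hBN hNU hNG using hN
  obtain ⟨C, hC, hCG, hCle⟩ := h.exists_compactSolid_approx hhull (half_pos hε)
  -- a point `g` is added to keep the compact set `K` below nonempty, so that filling in holes does
  -- not disconnect it
  obtain ⟨g, hg⟩ := hGne
  have hT : IsCompact (insert g (C \ (⋃ B, interior (N B)) ∪ ⋃ B, frontier (N B))) :=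
    ((hC.1.diff (isOpen_iUnion fun _ => isOpen_interior)).union (isCompact_iUnion fun B =>
      (hN B).of_isClosed_subset isClosed_frontier (hN B).isClosed.frontier_subset)).insert g
  obtain ⟨K, hK, hTK, hKG⟩ := exists_compactConn_between hT hG hGf.1
    (insert_subset hg (union_subset (by
      rintro x ⟨hxC, hx⟩
      rcases hCG hxC with hxG | ⟨B, hB, hxB⟩
      · exact hxG
      · exact (hx (mem_iUnion.2 ⟨⟨B, hB⟩, hBN ⟨B, hB⟩ hxB⟩)).elim) (iUnion_subset hNG)))
  have hNK : ∀ B, frontier (N B) ⊆ K := fun B x hx =>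
    hTK (Or.inr (Or.inr (mem_iUnion.2 ⟨B, hx⟩)))
  have hCK : C ⊆ solidHull K := by
    intro x hx
    by_cases hxK : x ∈ K
    · exact Or.inl hxK
    by_cases hxN : x ∈ ⋃ B, interior (N B)
    · obtain ⟨B, hB⟩ := mem_iUnion.1 hxN
      obtain ⟨H, hH, hxH⟩ := exists_mem_holes_of_frontier_subset (hN B) (hNK B) hB hxK
      exact subset_solidHull_of_mem_holes hH hxH
    · exact (hxK (hTK (Or.inr (Or.inl ⟨hx, hxN⟩)))).elim
  -- fill in the holes of `K` contained in `G`
  set F : Set (Set X) := {H | H ∈ holes K ∧ H ⊆ G} with hFdef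
  have hF : F ⊆ components Kᶜ := fun H hH => hH.1.1
  have hFcl : IsClosed (K ∪ ⋃₀ F) := by
    rw [← isOpen_compl_iff, compl_union_sUnion_components hF]
    exact isOpen_sUnion fun H hH => isOpen_of_mem_components hK.1.isClosed.isOpen_compl hH.1
  have hKne : K.Nonempty := ⟨g, hTK (mem_insert _ _)⟩
  have hE : K ∪ ⋃₀ F ∈ CompactConn := by
    refine ⟨(isCompact_solidHull hK.1).of_isClosed_subset hFcl
      (union_subset_union_right _ (sUnion_mono fun H hH => hH.1)), ?_⟩
    exact isPreconnected_union_sUnion hK.2 hKne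
      fun H hH => isPreconnected_union_component hK.2 hKne (hF hH)
  have hEG : K ∪ ⋃₀ F ⊆ G := union_subset hKG (sUnion_subset fun H hH => hH.2)
  have hholes : holes (K ∪ ⋃₀ F) = holes K \ F := by
    ext H
    simp only [holes, mem_ofPred_eq, components_compl_union_sUnion hF, mem_sdiff]
    tauto
  have hhullE : solidHull (K ∪ ⋃₀ F) = solidHull K := by
    rw [solidHull, hholes, union_assoc, ← sUnion_union, union_sdiff_cancel fun H hH => hH.1]
    rfl
  -- each remaining hole contains a hole of `G`
  have hφ : ∀ H : holes (K ∪ ⋃₀ F), ∃ B : holes G, (B : Set X) ⊆ H ∧ (H : Set X) ⊆ U B := by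
    intro ⟨H, hH⟩
    have hH' := hH
    rw [hholes] at hH'
    obtain ⟨x, hxH, hxG⟩ := not_subset.1 fun hHG => hH'.2 ⟨hH'.1, hHG⟩
    obtain ⟨B, hB, hxB⟩ := (solidHull_subset hhull.2.2
      (hKG.trans (subset_solidHull G)) (subset_solidHull_of_mem_holes hH'.1 hxH)).resolve_left hxG
    refine ⟨⟨B, hB⟩, ?_, ?_⟩
    · exact subset_of_mem_components_of_inter hH'.1.1 (isPreconnected_of_mem_components hB.1)
        ((subset_of_mem_components hB.1).trans (compl_subset_compl.2 hKG)) ⟨x, hxB, hxH⟩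
    · rcases subset_interior_or_of_disjoint_frontier (isPreconnected_of_mem_components hH'.1.1)
        (disjoint_compl_left.mono (subset_of_mem_components hH'.1.1) (hNK ⟨B, hB⟩)) with h | h
      · exact h.trans (interior_subset.trans (hNU ⟨B, hB⟩))
      · exact (h hxH (subset_closure (interior_subset (hBN ⟨B, hB⟩ hxB)))).elim
  choose φ hφ1 hφ2 using hφ
  have hφinj : Function.Injective φ := by
    intro H H' hHH'
    obtain ⟨x, hx⟩ := nonempty_of_mem_components (φ H).2.1
    exact Subtype.ext (eq_of_mem_components H.2.1 H'.2.1 ⟨x, hφ1 H hx, hφ1 H' (hHH' ▸ hx)⟩)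
  have hsum : ∑' H : holes (K ∪ ⋃₀ F), (lam H : ℝ≥0∞) ≤
      ∑' B : holes G, (lam B : ℝ≥0∞) + (ε / 2 : ℝ≥0) :=
    calc _ ≤ ∑' H : holes (K ∪ ⋃₀ F), (lam (U (φ H)) : ℝ≥0∞) := by
          gcongr with H
          exact h.mono_openSolid (mem_openSolid_of_mem_holes hE H.2) (hU _) (hφ2 H)
      _ ≤ ∑' B : holes G, (lam (U B) : ℝ≥0∞) :=
          ENNReal.tsum_comp_le_tsum_of_injective hφinj fun B => (lam (U B) : ℝ≥0∞)
      _ ≤ ∑' B : holes G, ((lam B : ℝ≥0∞) + δ B) := by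
          gcongr with B
          exact_mod_cast hUle B
      _ = ∑' B : holes G, (lam B : ℝ≥0∞) + ∑' B, (δ B : ℝ≥0∞) := ENNReal.tsum_add
      _ ≤ _ := by gcongr
  calc (lam (solidHull G) : ℝ≥0∞) ≤ lam C + (ε / 2 : ℝ≥0) := by exact_mod_cast hCle
    _ ≤ lam (solidHull (K ∪ ⋃₀ F)) + (ε / 2 : ℝ≥0) := by
        gcongr
        exact h.mono_compactSolid hC (solidHull_mem_compactSolid hE) (hhullE ▸ hCK)
    _ ≤ openValue lam G + (∑' B : holes G, (lam B : ℝ≥0∞) + (ε / 2 : ℝ≥0)) + (ε / 2 : ℝ≥0) := by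
        gcongr
        refine (lam_solidHull_le lam _).trans (add_le_add (connValue_le_openValue hE hEG) hsum)
    _ = openValue lam G + ∑' B : holes G, (lam B : ℝ≥0∞) + ε := by
        rw [← add_assoc, add_assoc _ ((ε / 2 : ℝ≥0) : ℝ≥0∞), ← ENNReal.coe_add, add_halves]

/-- The main inequality for additivity. Given a packing of `W` with union `L`, choose a compact
set `P ⊆ W \ K` such that `P` and its complement have finitely many components, containing the part
of `L` outside a small neighbourhood of `K` and the boundary of this neighbourhood. Then `L` is
covered by `P` and finitely many components of the complement of `P` which are close to `K`. -/
lemma openValue_le_add_sdiff (h : IsSolidSetFunction lam) (hK : IsCompact K) (hW : IsOpen W)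
    (hKW : K ⊆ W) : openValue lam W ≤ extension lam K + openValue lam (W \ K) := by
  classical
  refine ENNReal.le_of_forall_pos_le_add fun ε hε _ => ?_
  obtain ⟨V, hV, hKV, hVle⟩ := exists_isOpen_openValue_le (h.extension_lt_top hK).ne hε
  suffices hsuff : openValue lam W ≤ openValue lam V + openValue lam (W \ K) by
    refine hsuff.trans ((add_le_add_left hVle _).trans_eq ?_)
    rw [add_right_comm]
  refine iSup₂_le fun s hs => ?_
  have hs : IsPacking s W := hs
  obtain ⟨N, hN, hKN, hNV⟩ := exists_compact_between hK (hV.inter hW) (subset_inter hKV hKW)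
  set L := ⋃₀ (s : Set (Set X)) with hL
  have hP₀ : IsCompact (L \ interior N ∪ frontier N) :=
    (hs.isCompact_sUnion.diff isOpen_interior).union
      (hN.of_isClosed_subset isClosed_frontier hN.isClosed.frontier_subset)
  obtain ⟨P, hP, hP₀P, hPW, hPf, hPcf⟩ := exists_isCompact_finite_components_compl_between hP₀
    (hW.sdiff hK.isClosed) (union_subset
      (fun x hx => ⟨hs.sUnion_subset hx.1, fun hxK => hx.2 (hKN hxK)⟩)
      (fun x hx => ⟨(hNV (hN.isClosed.frontier_subset hx)).2, fun hxK => hx.2 (hKN hxK)⟩))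
  set Q : Set (Set X) := {G | G ∈ components Pᶜ ∧ G ⊆ interior N} with hQ
  have hQP : Q ⊆ components Pᶜ := fun G hG => hG.1
  have hQf : Q.Finite := hPcf.subset hQP
  have hTf : (components P ∪ Q).Finite := hPf.union hQf
  have hTunion : ⋃₀ (components P ∪ Q) = P ∪ ⋃₀ Q := by rw [sUnion_union, sUnion_components]
  have hTpre : ∀ A ∈ components P ∪ Q, IsPreconnected A := fun A hA =>
    hA.elim isPreconnected_of_mem_components fun hA => isPreconnected_of_mem_components hA.1
  have hTne : ∀ A ∈ components P ∪ Q, A.Nonempty := fun A hA =>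
    hA.elim nonempty_of_mem_components fun hA => nonempty_of_mem_components hA.1
  have hTd : (components P ∪ Q).PairwiseDisjoint id := by
    rw [pairwiseDisjoint_union]
    refine ⟨pairwiseDisjoint_components P, (pairwiseDisjoint_components Pᶜ).subset hQP, ?_⟩
    exact fun A hA B hB _ => disjoint_compl_right.mono (subset_of_mem_components hA)
      (subset_of_mem_components hB.1)
  have hPconn : ∀ A ∈ components P, A ∈ CompactConn := fun A hA =>
    ⟨hP.of_isClosed_subset (isClosed_of_mem_components hP.isClosed hA)
      (subset_of_mem_components hA), isPreconnected_of_mem_components hA⟩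
  have hQsemi : ∀ G ∈ Q, IsOpen G ∧ IsBdd G ∧ IsSemiSolid G := fun G hG =>
    ⟨isOpen_of_mem_components hP.isClosed.isOpen_compl hG.1,
      (isBdd_of_isCompact hN).mono (hG.2.trans interior_subset),
      isPreconnected_of_mem_components hG.1,
      finite_components_compl_of_mem_components hPcf (by rwa [compl_compl]) hG.1⟩
  have hT : ∀ A ∈ components P ∪ Q, A ∈ BddSemiSolid ∪ CompactConn := by
    rintro A (hA | hA)
    · exact Or.inr (hPconn A hA)
    · exact Or.inl ⟨(hQsemi A hA).2.2, Or.inr ⟨(hQsemi A hA).1, (hQsemi A hA).2.1⟩⟩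
  -- the compact set `E` tiled by the components of `P` and the members of `Q`
  set E := P ∪ ⋃₀ Q with hE
  have hEc : IsCompact E := by
    refine (hP.union hN).of_isClosed_subset ?_ (union_subset_union_right _
      (sUnion_subset fun G hG => hG.2.trans interior_subset))
    rw [← isOpen_compl_iff, compl_union_sUnion_components hQP]
    exact isOpen_sUnion fun H hH => isOpen_of_mem_components hP.isClosed.isOpen_compl hH.1
  have hLE : L ⊆ E := by
    intro x hx
    by_cases hxP : x ∈ P
    · exact Or.inl hxP
    obtain ⟨G, hG, hxG⟩ := exists_mem_components (S := Pᶜ) hxP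
    have hxN : x ∈ interior N := by
      by_contra hxN
      exact hxP (hP₀P (Or.inl ⟨hx, hxN⟩))
    refine Or.inr ⟨G, ⟨hG, ?_⟩, hxG⟩
    refine (subset_interior_or_of_disjoint_frontier (isPreconnected_of_mem_components hG)
      (disjoint_compl_left.mono (subset_of_mem_components hG)
        (subset_union_right.trans hP₀P))).resolve_right fun h => ?_
    exact h hxG (subset_closure (interior_subset hxN))
  have hEf : (components E).Finite := hTunion ▸ finite_components_sUnion hTf hTpre
  have hEcf : (components Eᶜ).Finite := by
    rw [components_compl_union_sUnion hQP]
    exact hPcf.subset sdiff_subset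
  have hEconn : ∀ C ∈ components E, C ∈ CompactConn := fun C hC =>
    ⟨hEc.of_isClosed_subset (isClosed_of_mem_components hEc.isClosed hC)
      (subset_of_mem_components hC), isPreconnected_of_mem_components hC⟩
  set T := hTf.toFinset with hTdef
  have hTmem : ∀ {A}, A ∈ T ↔ A ∈ components P ∪ Q := hTf.mem_toFinset
  have hEle : ∀ C ∈ components E,
      connValue lam C ≤ ∑ A ∈ T.filter (fun A => A ⊆ C), connValue lam A := by
    intro C hC
    refine h.connValue_le_sum (hEconn C hC)
      (finite_components_compl_of_mem_components hEf hEcf hC)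
      (fun A hA => hT A (hTmem.1 (Finset.mem_filter.1 hA).1))
      (fun A hA => hTne A (hTmem.1 (Finset.mem_filter.1 hA).1))
      (hTd.subset fun A hA => hTmem.1 (Finset.mem_filter.1 (Finset.mem_coe.1 hA)).1) ?_
    apply Subset.antisymm
    · exact sUnion_subset fun A hA => (Finset.mem_filter.1 (Finset.mem_coe.1 hA)).2
    · intro x hx
      have hxE := subset_of_mem_components hC hx
      rw [← hTunion] at hxE
      obtain ⟨A, hA, hxA⟩ := hxE
      refine ⟨A, Finset.mem_coe.2 (Finset.mem_filter.2 ⟨hTmem.2 hA, ?_⟩), hxA⟩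
      exact subset_of_mem_components_of_inter hC (hTpre A hA)
        ((subset_sUnion_of_mem hA).trans hTunion.subset) ⟨x, hxA, hx⟩
  calc ∑ A ∈ s, connValue lam A ≤ extension lam E :=
        IsPacking.sum_le_extension ⟨fun A hA => ⟨(hs.1 A hA).1,
          (subset_sUnion_of_mem (Finset.mem_coe.2 hA)).trans hLE⟩, hs.2⟩
    _ = ∑ C ∈ hEf.toFinset, connValue lam C := by
        have := h.extension_sUnion_of_isCompact (s := hEf.toFinset)
          (fun C hC => (hEconn C (hEf.mem_toFinset.1 hC)).1)
          (by rw [hEf.coe_toFinset]; exact pairwiseDisjoint_components E)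
        rw [hEf.coe_toFinset, sUnion_components] at this
        rw [this]
        exact Finset.sum_congr rfl fun C hC =>
          h.extension_of_mem_compactConn (hEconn C (hEf.mem_toFinset.1 hC))
    _ ≤ ∑ C ∈ hEf.toFinset, ∑ A ∈ T.filter (fun A => A ⊆ C), connValue lam A :=
        Finset.sum_le_sum fun C hC => hEle C (hEf.mem_toFinset.1 hC)
    _ = ∑ A ∈ hEf.toFinset.biUnion fun C => T.filter fun A => A ⊆ C, connValue lam A := by
        refine (Finset.sum_biUnion fun C hC D hD hCD => ?_).symm
        refine Finset.disjoint_left.2 fun A hA hA' => ?_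
        rw [Finset.mem_filter] at hA hA'
        obtain ⟨x, hx⟩ := hTne A (hTmem.1 hA.1)
        exact hCD (eq_of_mem_components (hEf.mem_toFinset.1 hC) (hEf.mem_toFinset.1 hD)
          ⟨x, hA.2 hx, hA'.2 hx⟩)
    _ ≤ ∑ A ∈ T, connValue lam A := Finset.sum_le_sum_of_subset
        (Finset.biUnion_subset.2 fun C _ => Finset.filter_subset _ _)
    _ ≤ ∑ A ∈ hPf.toFinset, connValue lam A + ∑ A ∈ hQf.toFinset, connValue lam A := by
        rw [hTdef, Finite.toFinset_union hPf hQf]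
        exact ennreal_sum_union_le _ _ _
    _ ≤ openValue lam (W \ K) + openValue lam V := by
        refine add_le_add (IsPacking.sum_le_openValue ⟨fun A hA => ?_, ?_⟩) ?_
        · rw [hPf.mem_toFinset] at hA
          exact ⟨hPconn A hA, (subset_of_mem_components hA).trans hPW⟩
        · rw [hPf.coe_toFinset]
          exact pairwiseDisjoint_components P
        · calc _ ≤ ∑ G ∈ hQf.toFinset, openValue lam G := by
                refine Finset.sum_le_sum fun G hG => ?_
                rw [hQf.mem_toFinset] at hG
                exact h.connValue_le_openValue_of_isOpen (hQsemi G hG).1 (hQsemi G hG).2.1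
                  (hQsemi G hG).2.2
            _ ≤ openValue lam (⋃₀ (hQf.toFinset : Set (Set X))) := h.sum_openValue_le (by
                rw [hQf.coe_toFinset]
                exact (pairwiseDisjoint_components Pᶜ).subset hQP)
            _ ≤ openValue lam V := openValue_mono (by
                rw [hQf.coe_toFinset]
                exact sUnion_subset fun G hG => (hG.2.trans interior_subset).trans
                  fun x hx => (hNV hx).1)
    _ = _ := add_comm _ _

end IsSolidSetFunction
end Additivity
end SolidTM

/-! ### Topological measures extending a solid set function -/

namespace SolidTM
section TopologicalMeasure
variable {X : Type*} [TopologicalSpace X] {lam : Set X → ℝ≥0} {μ ν : Set X → ℝ≥0∞}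
  {A B C K U : Set X}

lemma Extends.map_empty [ConnectedSpace X] [NoncompactSpace X] (he : Extends ν lam)
    (hlam : IsSolidSetFunction lam) : ν ∅ = 0 := by
  rw [he ∅ (Or.inl empty_mem_compactSolid), hlam.map_empty, ENNReal.coe_zero]

namespace IsTopologicalMeasure

lemma le_of_isCompact_of_isOpen (hν : IsTopologicalMeasure ν) (hK : IsCompact K)
    (hU : IsOpen U) (h : K ⊆ U) : ν K ≤ ν U := by
  rw [hν.inner_regular U hU]
  exact le_iSup₂_of_le (f := fun (K : Set X) (_ : K ∈ {K : Set X | IsCompact K ∧ K ⊆ U}) => ν K)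
    K ⟨hK, h⟩ le_rfl

lemma mono_of_isOpen (hν : IsTopologicalMeasure ν) (hA : IsOpen A) (hB : IsOpen B) (h : A ⊆ B) :
    ν A ≤ ν B := by
  rw [hν.inner_regular A hA]
  exact iSup₂_le fun K hK => hν.le_of_isCompact_of_isOpen hK.1 hB (hK.2.trans h)

lemma mono_of_isClosed (hν : IsTopologicalMeasure ν) (hA : IsClosed A) (hB : IsClosed B)
    (h : A ⊆ B) : ν A ≤ ν B := by
  rw [hν.outer_regular A hA, hν.outer_regular B hB]
  exact le_iInf₂ fun U hU => iInf₂_le U ⟨hU.1, h.trans hU.2⟩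

lemma biUnion_of_isCompact (hν : IsTopologicalMeasure ν) (h0 : ν ∅ = 0) {ι : Type*}
    {t : Finset ι} {K : ι → Set X} (hK : ∀ i ∈ t, IsCompact (K i))
    (hd : (t : Set ι).PairwiseDisjoint K) : ν (⋃ i ∈ t, K i) = ∑ i ∈ t, ν (K i) := by
  classical
  induction t using Finset.induction_on with
  | empty => simpa
  | insert i t hi ih =>
    have hK' : ∀ j ∈ t, IsCompact (K j) := fun j hj => hK j (Finset.mem_insert_of_mem hj)
    have hi' := hK i (Finset.mem_insert_self _ _)
    have ht := t.isCompact_biUnion hK'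
    rw [Finset.coe_insert] at hd
    rw [Finset.set_biUnion_insert, Finset.sum_insert hi, ← ih hK' (hd.subset (subset_insert _ _)),
      hν.additive _ _ (Or.inl hi') (Or.inl ht) (Or.inl (hi'.union ht))]
    refine disjoint_iUnion₂_right.2 fun j hj => hd (mem_insert _ _) (mem_insert_of_mem _ hj) ?_
    rintro rfl
    exact hi hj

lemma biUnion_of_isOpen (hν : IsTopologicalMeasure ν) (h0 : ν ∅ = 0) {ι : Type*}
    {t : Finset ι} {K : ι → Set X} (hK : ∀ i ∈ t, IsOpen (K i))
    (hd : (t : Set ι).PairwiseDisjoint K) : ν (⋃ i ∈ t, K i) = ∑ i ∈ t, ν (K i) := by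
  classical
  induction t using Finset.induction_on with
  | empty => simpa
  | insert i t hi ih =>
    have hK' : ∀ j ∈ t, IsOpen (K j) := fun j hj => hK j (Finset.mem_insert_of_mem hj)
    have hi' := hK i (Finset.mem_insert_self _ _)
    have ht : IsOpen (⋃ j ∈ t, K j) := isOpen_biUnion hK'
    rw [Finset.coe_insert] at hd
    rw [Finset.set_biUnion_insert, Finset.sum_insert hi, ← ih hK' (hd.subset (subset_insert _ _)),
      hν.additive _ _ (Or.inr hi') (Or.inr ht) (Or.inr (hi'.union ht))]
    refine disjoint_iUnion₂_right.2 fun j hj => hd (mem_insert _ _) (mem_insert_of_mem _ hj) ?_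
    rintro rfl
    exact hi hj

lemma iUnion_of_isCompact (hν : IsTopologicalMeasure ν) (h0 : ν ∅ = 0) {ι : Type*} [Fintype ι]
    {K : ι → Set X} (hK : ∀ i, IsCompact (K i)) (hd : Pairwise (Function.onFun Disjoint K)) :
    ν (⋃ i, K i) = ∑ i, ν (K i) := by
  simpa using hν.biUnion_of_isCompact h0 (t := Finset.univ) (fun i _ => hK i)
    fun i _ j _ hij => hd hij

/-- A topological measure is countably additive, and more, on disjoint open sets. -/
lemma sUnion_of_isOpen (hν : IsTopologicalMeasure ν) (h0 : ν ∅ = 0) {F : Set (Set X)}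
    (hF : ∀ U ∈ F, IsOpen U) (hd : F.PairwiseDisjoint id) :
    ν (⋃₀ F) = ∑' U : F, ν U := by
  apply le_antisymm
  · rw [hν.inner_regular _ (isOpen_sUnion hF)]
    refine iSup₂_le fun K hK => ?_
    have hcov : K ⊆ ⋃ U : F, (U : Set X) := by
      rw [← sUnion_eq_iUnion]
      exact hK.2
    obtain ⟨t, ht⟩ := hK.1.elim_finite_subcover (fun U : F => (U : Set X)) (fun U => hF U U.2) hcov
    calc ν K ≤ ν (⋃ U ∈ t, (U : Set X)) :=
          hν.le_of_isCompact_of_isOpen hK.1 (isOpen_biUnion fun U _ => hF U U.2) ht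
      _ = ∑ U ∈ t, ν U := hν.biUnion_of_isOpen h0 (fun U _ => hF U U.2)
          fun U _ V _ hUV => hd U.2 V.2 fun he => hUV (Subtype.ext he)
      _ ≤ _ := ENNReal.sum_le_tsum t
  · rw [ENNReal.tsum_eq_iSup_sum]
    refine iSup_le fun t => ?_
    rw [← hν.biUnion_of_isOpen h0 (K := fun U : F => (U : Set X)) (fun U _ => hF U U.2)
      fun U _ V _ hUV => hd U.2 V.2 fun he => hUV (Subtype.ext he)]
    exact hν.mono_of_isOpen (isOpen_biUnion fun U _ => hF U U.2) (isOpen_sUnion hF)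
      (iUnion₂_subset fun U _ => subset_sUnion_of_mem U.2)

variable [T2Space X] [LocallyCompactSpace X] [LocallyConnectedSpace X]

lemma eq_iSup_compactConnUnion (hν : IsTopologicalMeasure ν) (hU : IsOpen U) :
    ν U = ⨆ K ∈ {K | K ∈ CompactConnUnion ∧ K ⊆ U}, ν K := by
  have hcompact : ∀ K ∈ (CompactConnUnion : Set (Set X)), IsCompact K := by
    rintro _ ⟨n, K, hK, -, rfl⟩
    exact isCompact_iUnion fun i => (hK i).1
  apply le_antisymm
  · rw [hν.inner_regular U hU]
    refine iSup₂_le fun K hK => ?_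
    obtain ⟨P, hP, hKP, hPU, hPf⟩ := exists_isCompact_finite_components_between hK.1 hU hK.2
    refine (hν.mono_of_isClosed hK.1.isClosed hP.isClosed hKP).trans ?_
    refine le_iSup₂_of_le (f := fun (K : Set X) (_ : K ∈ {K : Set X | K ∈ CompactConnUnion ∧
      K ⊆ U}) => ν K) P ⟨?_, hPU⟩ le_rfl
    let e := hPf.toFinset.equivFin
    have hmem : ∀ i, (e.symm i : Set X) ∈ components P := fun i => hPf.mem_toFinset.1 (e.symm i).2
    refine ⟨_, fun i => e.symm i, fun i => ⟨?_, isPreconnected_of_mem_components (hmem i)⟩, ?_, ?_⟩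
    · exact hP.of_isClosed_subset (isClosed_of_mem_components hP.isClosed (hmem i))
        (subset_of_mem_components (hmem i))
    · exact fun i j hij => disjoint_of_mem_components (hmem i) (hmem j)
        fun he => hij (e.symm.injective (Subtype.ext he))
    · rw [e.symm.surjective.iUnion_comp fun C : hPf.toFinset => (C : Set X)]
      conv_lhs => rw [← sUnion_components P]
      ext x
      simp
  · exact iSup₂_le fun K hK => hν.le_of_isCompact_of_isOpen (hcompact K hK.1) hU hK.2

variable [ConnectedSpace X] [NoncompactSpace X]

/-- A topological measure extending `lam` has the expected value on compact connected and bounded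
semi-solid sets. -/
lemma add_tsum_holes (hν : IsTopologicalMeasure ν) (hlam : IsSolidSetFunction lam)
    (he : Extends ν lam) (hA : A ∈ BddSemiSolid ∪ CompactConn) :
    ν A + ∑' B : holes A, (lam B : ℝ≥0∞) = lam (solidHull A) := by
  have h0 : ν ∅ = 0 := he.map_empty hlam
  have hsum : ∑' B : holes A, (lam B : ℝ≥0∞) = ∑' B : holes A, ν B :=
    tsum_congr fun B => (he B (holes_subset_bddSolid hA B.2)).symm
  have hd : (holes A).PairwiseDisjoint id :=
    (pairwiseDisjoint_components Aᶜ).subset (holes_subset_components A)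
  have hdA : Disjoint A (⋃₀ holes A) :=
    disjoint_sUnion_right.2 fun B hB => disjoint_of_mem_holes hB
  rw [← he _ (solidHull_mem_bddSolid hA), hsum, solidHull]
  have hcompact : A ∈ CompactConn → ν A + ∑' B : holes A, ν B = ν (A ∪ ⋃₀ holes A) := by
    intro hc
    have ho : ∀ B ∈ holes A, IsOpen B := fun B hB => (mem_openSolid_of_mem_holes hc hB).1
    rw [← hν.sUnion_of_isOpen h0 ho hd]
    exact (hν.additive _ _ (Or.inl hc.1) (Or.inr (isOpen_sUnion ho))
      (Or.inl (isCompact_solidHull hc.1)) hdA).symm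
  rcases hA with ⟨hs, hc | ⟨ho, hb⟩⟩ | hc
  · exact hcompact ⟨hc, hs.1⟩
  · have hfin : (holes A).Finite := hs.2.subset (holes_subset_components A)
    have hB : ∀ B ∈ holes A, IsCompact B := fun B hB => (mem_compactSolid_of_mem_holes ho hs.1 hB).1
    have : Fintype (holes A) := hfin.fintype
    rw [hν.additive _ _ (Or.inr ho) (Or.inl (hfin.isCompact_sUnion hB))
      (Or.inr (solidHull_mem_openSolid ho hb hs).1) hdA, tsum_fintype, sUnion_eq_iUnion,
      hν.iUnion_of_isCompact h0 (K := fun B : holes A => (B : Set X)) (fun B => hB B B.2)]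
    exact fun B C hBC => hd B.2 C.2 fun he => hBC (Subtype.ext he)
  · exact hcompact hc

lemma eq_of_extends (hν : IsTopologicalMeasure ν) (hμ : IsTopologicalMeasure μ)
    (hlam : IsSolidSetFunction lam) (hνe : Extends ν lam) (hμe : Extends μ lam)
    (hA : IsOpen A ∨ IsClosed A) : ν A = μ A := by
  have hconn : ∀ K ∈ (CompactConn : Set (Set X)), ν K = μ K := by
    intro K hK
    have h1 := hν.add_tsum_holes hlam hνe (Or.inr hK)
    rw [← hμ.add_tsum_holes hlam hμe (Or.inr hK)] at h1
    exact (ENNReal.add_left_inj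
      (ne_top_of_le_ne_top ENNReal.coe_ne_top (hlam.tsum_holes_le hK))).1 h1
  have hunion : ∀ K ∈ (CompactConnUnion : Set (Set X)), ν K = μ K := by
    rintro _ ⟨n, K, hK, hd, rfl⟩
    rw [hν.iUnion_of_isCompact (hνe.map_empty hlam) (fun i => (hK i).1) hd,
      hμ.iUnion_of_isCompact (hμe.map_empty hlam) (fun i => (hK i).1) hd]
    exact Finset.sum_congr rfl fun i _ => hconn _ (hK i)
  have hopen : ∀ U, IsOpen U → ν U = μ U := fun U hU => by
    rw [hν.eq_iSup_compactConnUnion hU, hμ.eq_iSup_compactConnUnion hU]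
    exact iSup_congr fun K => iSup_congr fun hK => hunion K hK.1
  rcases hA with hA | hA
  · exact hopen A hA
  · rw [hν.outer_regular A hA, hμ.outer_regular A hA]
    exact iInf_congr fun U => iInf_congr fun hU => hopen U hU.1

end IsTopologicalMeasure

namespace IsSolidSetFunction
variable [T2Space X] [LocallyCompactSpace X] [ConnectedSpace X] [LocallyConnectedSpace X]
  [NoncompactSpace X]

lemma openValue_eq_add_sdiff (h : IsSolidSetFunction lam) (hK : IsCompact K) (hU : IsOpen U)
    (hKU : K ⊆ U) : openValue lam U = extension lam K + openValue lam (U \ K) :=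
  le_antisymm (h.openValue_le_add_sdiff hK hU hKU) (h.extension_add_openValue_sdiff_le hU hKU)

lemma extension_union_of_isCompact_of_isOpen (h : IsSolidSetFunction lam) (hA : IsCompact A)
    (hB : IsOpen B) (hAB : IsCompact (A ∪ B) ∨ IsOpen (A ∪ B)) (hd : Disjoint A B) :
    extension lam (A ∪ B) = extension lam A + extension lam B := by
  rw [extension_of_isOpen hB]
  rcases hAB with hAB | hAB
  · -- compare both sides inside an open set of finite value
    obtain ⟨C, hC, hABC⟩ := exists_compactSolid_superset hAB
    obtain ⟨W, hW, hCW, -⟩ := h.exists_openSolid_approx hC one_pos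
    have hABW := hABC.trans hCW
    have h1 := h.openValue_eq_add_sdiff hAB hW.1 hABW
    have h2 := h.openValue_eq_add_sdiff hA hW.1 (subset_union_left.trans hABW)
    have hsplit : W \ A = B ∪ W \ (A ∪ B) := by
      ext x
      constructor
      · rintro ⟨hx, hxA⟩
        by_cases hxB : x ∈ B
        · exact Or.inl hxB
        · exact Or.inr ⟨hx, fun hh => hh.elim hxA hxB⟩
      · rintro (hx | ⟨hx, hx'⟩)
        · exact ⟨hABW (Or.inr hx), fun hxA => disjoint_left.1 hd hxA hx⟩
        · exact ⟨hx, fun hxA => hx' (Or.inl hxA)⟩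
    rw [hsplit, h.openValue_union hB (hW.1.sdiff hAB.isClosed)
      (disjoint_sdiff_right.mono_left subset_union_right), ← add_assoc, h1] at h2
    refine (ENNReal.add_left_inj (ne_top_of_le_ne_top (b := openValue lam W) ?_
      (openValue_mono sdiff_subset))).1 h2
    rw [h.openValue_of_mem_openSolid hW]
    exact ENNReal.coe_ne_top
  · rw [extension_of_isOpen hAB, h.openValue_eq_add_sdiff hA hAB subset_union_left,
      union_sdiff_cancel_left (Set.disjoint_iff.1 hd)]

lemma extension_extends (h : IsSolidSetFunction lam) : Extends (extension lam) lam :=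
  fun _ hA => h.extension_of_mem_bddSolid hA

lemma isTopologicalMeasure_extension (h : IsSolidSetFunction lam) :
    IsTopologicalMeasure (extension lam) where
  not_top := ⟨∅, Or.inl isOpen_empty, (h.extension_lt_top isCompact_empty).ne⟩
  additive A B hA hB hAB hd := by
    rcases hA with hA | hA <;> rcases hB with hB | hB
    · exact h.extension_union_of_isCompact hA hB hd
    · exact h.extension_union_of_isCompact_of_isOpen hA hB hAB hd
    · rw [union_comm, add_comm]
      exact h.extension_union_of_isCompact_of_isOpen hB hA (union_comm A B ▸ hAB) hd.symm
    · rw [extension_of_isOpen (hA.union hB), extension_of_isOpen hA, extension_of_isOpen hB,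
        h.openValue_union hA hB hd]
  inner_regular U hU := by
    apply le_antisymm
    · rw [extension_of_isOpen hU]
      refine iSup₂_le fun s hs => ?_
      have hs : IsPacking s U := hs
      have hs' : IsPacking s (⋃₀ (s : Set (Set X))) :=
        ⟨fun K hK => ⟨(hs.1 K hK).1, subset_sUnion_of_mem (Finset.mem_coe.2 hK)⟩, hs.2⟩
      exact hs'.sum_le_extension.trans (le_iSup₂_of_le (f := fun (K : Set X)
        (_ : K ∈ {K : Set X | IsCompact K ∧ K ⊆ U}) => extension lam K) _
        ⟨hs.isCompact_sUnion, hs.sUnion_subset⟩ le_rfl)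
    · exact iSup₂_le fun K hK => extension_mono hK.2
  outer_regular F _ := iInf_congr fun U => iInf_congr fun hU => (extension_of_isOpen hU.1).symm

end IsSolidSetFunction
end TopologicalMeasure
end SolidTM

theorem theorem7 {X : Type*} [TopologicalSpace X] [T2Space X] [LocallyCompactSpace X]
    [ConnectedSpace X] [LocallyConnectedSpace X] [NoncompactSpace X]
    (lam : Set X → ℝ≥0) (hlam : SolidTM.IsSolidSetFunction lam) :
    ∃ μ : Set X → ℝ≥0∞,
      -- existence of the extension
      (SolidTM.IsTopologicalMeasure μ ∧ SolidTM.IsCompactFinite μ ∧ SolidTM.Extends μ lam) ∧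
      -- uniqueness, among all topological measures
      (∀ ν : Set X → ℝ≥0∞, SolidTM.IsTopologicalMeasure ν → SolidTM.Extends ν lam →
        ∀ A : Set X, IsOpen A ∨ IsClosed A → ν A = μ A) ∧
      -- values on bounded semi-solid and compact connected sets
      (∀ A ∈ (SolidTM.BddSemiSolid ∪ SolidTM.CompactConn : Set (Set X)),
        SolidTM.solidHull A ∈ SolidTM.BddSolid ∧ SolidTM.holes A ⊆ SolidTM.BddSolid ∧
        μ A + ∑' B : SolidTM.holes A, (lam B : ℝ≥0∞) = lam (SolidTM.solidHull A)) ∧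
      -- values on finite disjoint unions of compact connected sets
      (∀ (n : ℕ) (K : Fin n → Set X), (∀ i, K i ∈ SolidTM.CompactConn) →
        Pairwise (Function.onFun Disjoint K) → μ (⋃ i, K i) = ∑ i, μ (K i)) ∧
      -- values on open sets and on closed sets
      (∀ U : Set X, IsOpen U → μ U = ⨆ K ∈ {K | K ∈ SolidTM.CompactConnUnion ∧ K ⊆ U}, μ K) ∧
      (∀ F : Set X, IsClosed F → μ F = ⨅ U ∈ {U : Set X | IsOpen U ∧ F ⊆ U}, μ U) := by
  have hμ := hlam.isTopologicalMeasure_extension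
  have hμe := hlam.extension_extends
  refine ⟨SolidTM.extension lam, ⟨hμ, fun K hK => hlam.extension_lt_top hK, hμe⟩, ?_, ?_, ?_, ?_,
    hμ.outer_regular⟩
  · exact fun ν hν hνe A hA => hν.eq_of_extends hμ hlam hνe hμe hA
  · exact fun A hA => ⟨SolidTM.solidHull_mem_bddSolid hA, SolidTM.holes_subset_bddSolid hA,
      hμ.add_tsum_holes hlam hμe hA⟩
  · exact fun n K hK hd => hμ.iUnion_of_isCompact
      (hμe.map_empty hlam) (fun i => (hK i).1) hd
  · exact fun U hU => hμ.eq_iSup_compactConnUnion hU
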